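/- **Setting.** Let $(X_t,Y_t)_{t\ge 1}$ be a process with values in $\mathbb R^2$ on a probability space $(\Omega,\mathcal F,\mathbb P)$, let $\mathcal Y_t=\sigma(Y_1,\dots,Y_t)$, let $\mu<0$ and let $(Q_t)_{t\ge1}$ be nonnegative real numbers. Let $(\bar\varepsilon_t)_{t\ge 1}$ be i.i.d. $\mathcal N(0,1)$ random variables, independent of $(X_t,Y_t)_{t\ge1}$. A sequence $h=(h_t)_{t\ge1}$ is called adapted if $h_t$ is $\mathcal Y_t$-measurable for all $t\ge 1$. For $T\ge 0$, an adapted $h$ solves the *LEG filtering problem* with horizon $T$ if it minimizes $\mathbb E\,\mu\exp\{\frac{\mu}{2}\sum_{t=1}^T(X_t-h_t)^2Q_t\}$ over all adapted sequences. It solves the *RS filtering problem* up to $T$ if for every $1\le t\le T$ the variable $g=h_t$ minimizes almost surely, among all $\mathcal Y_t$-measurable $g$, the conditional expectation $$\mathbb E\Big[\mu\exp\Big\{\tfrac{\mu}{2}(X_t-g)^2Q_t+\tfrac{\mu}{2}\sum_{s=1}^{t-1}(X_s-h_s)^2Q_s\Big\}\Big/\mathcal Y_t\Big].$$ Put $q_t=-\mu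 Q_t$ (so $q_t=Q_t$ for $\mu=-1$). For adapted $h$ let $$Y^2_t=q_t(X_t-h_t)+\sqrt{q_t}\,\bar\varepsilon_t,\qquad \xi_t=\sum_{s=1}^t(X_s-h_s)Y^2_s ,$$ where the $2$ in $Y^2$ is a superscript, $\bar{\mathcal Y}_{t,t-1}=\sigma(Y_s,Y^2_r:1\le s\le t,\,1\le r\le t-1)$, $\bar{\mathcal Y}_{t}=\sigma(Y_s,Y^2_s:1\le s\le t)$, and $$\widetilde Z^h_t=\mathbb E[X_t/\bar{\mathcal Y}_{t,t-1}]-\mathbb E\big[(X_t-\mathbb E[X_t/\bar{\mathcal Y}_{t,t-1}])(\xi_{t-1}-\mathbb E[\xi_{t-1}/\bar{\mathcal Y}_{t-1}])\big/\bar{\mathcal Y}_{t,t-1}\big],$$ the conditional expectations in $\widetilde Z^h_t$ being means of regular conditional distributions (the usual conditional expectations whenever the variables are integrable). Call $(X,Y)$ *conditionally Gaussian* if for every $t\ge1$ the conditional distribution of $(X_1,\dots,X_t)$ given $\mathcal Y_t$ is almost surely Gaussian. **Statement.** 1. Suppose that $(X,Y)$ is jointly Gaussian or conditionally Gaussian.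 Then there is an adapted $\bar h$ with $\bar h_t=\widetilde Z^{\bar h}_t$ a.s. for all $t\ge 1$. Moreover, for every $T$, an adapted $h$ solves the RS filtering problem up to $T$ if and only if $h_t=\widetilde Z^h_t$ a.s. for every $1\le t\le T$ with $Q_t>0$. 2. Suppose that $(X,Y)$ is jointly Gaussian, or conditionally Gaussian with the conditional covariance matrix of $(X_1,\dots,X_t)$ given $\mathcal Y_t$ almost surely equal to a deterministic matrix for every $t\ge1$. Then, for every $T$, an adapted $h$ solves the LEG filtering problem with horizon $T$ if and only if $h_t=\widetilde Z^h_t$ a.s. for every $1\le t\le T$ with $Q_t>0$. In particular $\bar h$ solves the RS problem, and in the setting of part 2 also the LEG problem, for every $T$; and if all $Q_t$ are positive, every solution $\bar h$ satisfies $\bar h_t=\widetilde Z^{\bar h}_t$ a.s. for all $1\le t\le T$. -/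

import Mathlib

open MeasureTheory ProbabilityTheory

namespace LEGFiltering

variable {Ω : Type*} [MeasurableSpace Ω]

/-- The random vector `(Y_1, …, Y_t)`. -/
def obsVec (Y : ℕ → Ω → ℝ) (t : ℕ) : Ω → (Finset.Icc 1 t → ℝ) :=
  fun ω i => Y i ω

/-- The natural filtration `𝒴_t = σ(Y_1, …, Y_t)`. -/
@[reducible] def obsSigma (Y : ℕ → Ω → ℝ) (t : ℕ) : MeasurableSpace Ω :=
  MeasurableSpace.comap (obsVec Y t) inferInstance

/-- `h_t ∈ 𝒴_t` for every `t ≥ 1`. -/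
def IsAdapted (Y h : ℕ → Ω → ℝ) : Prop :=
  ∀ t, 1 ≤ t → Measurable[obsSigma Y t] (h t)

/-- The quadratic functional `∑_{s=1}^{t} (X_s - h_s)² Q_s`. -/
noncomputable def quadCost (X : ℕ → Ω → ℝ) (Q : ℕ → ℝ) (h : ℕ → Ω → ℝ) (t : ℕ) : Ω → ℝ :=
  fun ω => ∑ s ∈ Finset.Icc 1 t, (X s ω - h s ω) ^ 2 * Q s

/-- The exponential criterion `E μ exp{(μ/2) ∑_{t=1}^{T} (X_t - h_t)² Q_t}`. -/
noncomputable def legRisk (P : Measure Ω) (X : ℕ → Ω → ℝ) (Q : ℕ → ℝ) (μ : ℝ) (T : ℕ)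
    (h : ℕ → Ω → ℝ) : ℝ :=
  ∫ ω, μ * Real.exp (μ / 2 * quadCost X Q h T ω) ∂P

/-- `h` solves the LEG filtering problem with horizon `T`: it minimizes the exponential criterion
over all adapted sequences. -/
def IsLEGSolution (P : Measure Ω) (X Y : ℕ → Ω → ℝ) (Q : ℕ → ℝ) (μ : ℝ) (T : ℕ)
    (h : ℕ → Ω → ℝ) : Prop :=
  IsAdapted Y h ∧ ∀ h', IsAdapted Y h' → legRisk P X Q μ T h ≤ legRisk P X Q μ T h'

/-- The one-step conditional criterion
`E[μ exp{(μ/2)(X_t - g)² Q_t + (μ/2) ∑_{s=1}^{t-1} (X_s - h_s)² Q_s} | 𝒴_t]`. -/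
noncomputable def rsRisk (P : Measure Ω) (X Y : ℕ → Ω → ℝ) (Q : ℕ → ℝ) (μ : ℝ)
    (h : ℕ → Ω → ℝ) (t : ℕ) (g : Ω → ℝ) : Ω → ℝ :=
  P[fun ω => μ * Real.exp (μ / 2 * ((X t ω - g ω) ^ 2 * Q t) + μ / 2 * quadCost X Q h (t - 1) ω)
    | obsSigma Y t]

/-- `h` solves the risk-sensitive filtering problem up to time `T`: for each `1 ≤ t ≤ T`, given its
own past, `h_t` minimizes the conditional criterion almost surely over all `g ∈ 𝒴_t`. -/
def IsRSSolution (P : Measure Ω) (X Y : ℕ → Ω → ℝ) (Q : ℕ → ℝ) (μ : ℝ) (T : ℕ)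
    (h : ℕ → Ω → ℝ) : Prop :=
  IsAdapted Y h ∧ ∀ t ∈ Finset.Icc 1 T, ∀ g : Ω → ℝ, Measurable[obsSigma Y t] g →
    rsRisk P X Y Q μ h t (h t) ≤ᵐ[P] rsRisk P X Y Q μ h t g

/-- The conditional expectation of `U` given `W`, as the mean of the regular conditional
distribution of `U` given `W`. It is meaningful also when `U` is not integrable under `P` but is
so conditionally on `W`. -/
noncomputable def regCondExp {β : Type*} [MeasurableSpace β] (P : Measure Ω) [IsFiniteMeasure P]
    (W : Ω → β) (U : Ω → ℝ) : Ω → ℝ :=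
  fun ω => ∫ u, u ∂(condDistrib U W P (W ω))

/-- For integrable random variables `regCondExp` is the usual conditional expectation. -/
theorem regCondExp_ae_eq_condExp {β : Type*} [mβ : MeasurableSpace β] (P : Measure Ω)
    [IsFiniteMeasure P] {W : Ω → β} (hW : Measurable W) {U : Ω → ℝ} (hU : Integrable U P) :
    regCondExp P W U =ᵐ[P] P[U | MeasurableSpace.comap W mβ] :=
  (condExp_ae_eq_integral_condDistrib' hW hU).symm

/-- The auxiliary observation `Y²_s = q_s (X_s - h_s) + √q_s ε_s` (the `2` is a superscript). -/
noncomputable def auxObs (X ε : ℕ → Ω → ℝ) (q : ℕ → ℝ) (h : ℕ → Ω → ℝ) (s : ℕ) : Ω → ℝ :=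
  fun ω => q s * (X s ω - h s ω) + √(q s) * ε s ω

/-- `ξ_t = ∑_{s=1}^{t} (X_s - h_s) Y²_s`. -/
noncomputable def xi (X ε : ℕ → Ω → ℝ) (q : ℕ → ℝ) (h : ℕ → Ω → ℝ) (t : ℕ) : Ω → ℝ :=
  fun ω => ∑ s ∈ Finset.Icc 1 t, (X s ω - h s ω) * auxObs X ε q h s ω

/-- The random vector `(Y_1, …, Y_t, Y²_1, …, Y²_r)`, which generates the augmented observation
σ-field (`𝒴̄_{t,t-1}` for `r = t - 1`, and `𝒴̄_t` for `r = t`). -/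
noncomputable def augVec (X Y ε : ℕ → Ω → ℝ) (q : ℕ → ℝ) (h : ℕ → Ω → ℝ) (t r : ℕ) :
    Ω → (Finset.Icc 1 t → ℝ) × (Finset.Icc 1 r → ℝ) :=
  fun ω => (obsVec Y t ω, obsVec (auxObs X ε q h) r ω)

/-- `Z̃^h_t = E[X_t | 𝒴̄_{t,t-1}]
  - E[(X_t - E[X_t | 𝒴̄_{t,t-1}]) (ξ_{t-1} - E[ξ_{t-1} | 𝒴̄_{t-1}]) | 𝒴̄_{t,t-1}]`. -/
noncomputable def Ztilde (P : Measure Ω) [IsFiniteMeasure P] (X Y ε : ℕ → Ω → ℝ) (q : ℕ → ℝ)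
    (h : ℕ → Ω → ℝ) (t : ℕ) : Ω → ℝ :=
  let W := augVec X Y ε q h t (t - 1)
  let W' := augVec X Y ε q h (t - 1) (t - 1)
  fun ω => regCondExp P W (X t) ω
    - regCondExp P W (fun ω' => (X t ω' - regCondExp P W (X t) ω')
        * (xi X ε q h (t - 1) ω' - regCondExp P W' (xi X ε q h (t - 1)) ω')) ω

/-- The process `(X_t, Y_t)_{t ≥ 1}` is (jointly) Gaussian. -/
def IsJointlyGaussian (P : Measure Ω) (X Y : ℕ → Ω → ℝ) : Prop :=
  IsGaussianProcess (fun (t : Set.Ici (1 : ℕ)) ω => (X t ω, Y t ω)) P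

/-- The process `(X_t, Y_t)_{t ≥ 1}` is conditionally Gaussian: for every `t ≥ 1` the conditional
distribution of `(X_1, …, X_t)` given `(Y_1, …, Y_t)` is almost surely Gaussian. -/
def IsCondGaussian (P : Measure Ω) [IsFiniteMeasure P] (X Y : ℕ → Ω → ℝ) : Prop :=
  ∀ t, 1 ≤ t → ∀ᵐ y ∂(P.map (obsVec Y t)),
    IsGaussian (condDistrib (obsVec X t) (obsVec Y t) P y)

/-- For every `t ≥ 1` the conditional covariance matrix of `(X_1, …, X_t)` given `(Y_1, …, Y_t)`
is almost surely equal to a deterministic matrix. -/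
def HasNonrandomCondCov (P : Measure Ω) [IsFiniteMeasure P] (X Y : ℕ → Ω → ℝ) : Prop :=
  ∀ t, 1 ≤ t → ∃ C : Matrix (Finset.Icc 1 t) (Finset.Icc 1 t) ℝ,
    ∀ᵐ y ∂(P.map (obsVec Y t)), ∀ i j,
      cov[fun x => x i, fun x => x j; condDistrib (obsVec X t) (obsVec Y t) P y] = C i j

end LEGFiltering

/-! The link between the exponential criterion and the auxiliary observations is Bayes' formula. Let
`γ` be the conditional law of `x = (X_1, …, X_t)` given `𝒴_t`. Observing in addition `Y²_1 = z_1, …,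
Y²_{t-1} = z_{t-1}` multiplies `γ`, up to normalization, by `exp ∑ (z_s (x_s - h_s) - q_s (x_s -
h_s)² / 2)` (`condDistrib_withDensity`, `map_pi_gaussianReal`). The quadratic part is exactly the
weight of the past errors in the criterion, since `q = -μ Q`. The linear part is an exponential tilt
of a Gaussian law: it keeps all covariances and shifts the mean of `x_t` by its covariance with `∑
z_s x_s`, hence with `ξ_{t-1}`. Subtracting this covariance, as `Ztilde` does, undoes the shift. So
`Ztilde` is the mean of `x_t` under `γ` weighted by the past errors alone, and no longer depends on
`z` (`mean_sub_cov_likWeight`, `Ztilde_ae_eq`).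

This tilted mean `a` is also the one-step optimizer. The weighted law is again Gaussian, with some
variance `V` of `x_t`, and integrating one more Gaussian weight centred at `g` gives a factor `(1 +
q_t V)^{-1/2} exp(-q_t (a - g)² / (2 (1 + q_t V)))` (`exists_integral_quadWeight_mul`). It is
largest at `g = a`, and only there if `q_t > 0`; as `μ < 0`, this settles the RS problem
(`isRSSolution_iff`).

For the LEG problem, `V` depends on `γ` only through its covariances. If these are deterministic, so
is `c_t = (1 + q_t V)^{-1/2}`, and the expected weights satisfy `E_t ≤ c_t E_{t-1}` with equality
iff `h_t = a` or `Q_t = 0` (`exists_expWeight_le`). Multiplying these bounds gives a maximum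
independent of `h`, attained exactly when every step is an equality (`exists_expWeight_max`). Joint
Gaussianity reduces to this case by linear regression. -/

namespace LEGFiltering
open scoped ENNReal NNReal

/-! ### Gaussian laws weighted by a function of one linear functional. -/

section

/-- Exponential tilting of a real Gaussian law shifts its mean by its variance. -/
lemma gaussianReal_withDensity_exp (a : ℝ) (v : ℝ≥0) :
    (gaussianReal a v).withDensity (fun u => ENNReal.ofReal (Real.exp u))
      = ENNReal.ofReal (Real.exp (a + v / 2)) • gaussianReal (a + v) v := by
  rcases eq_or_ne v 0 with rfl | hv
  · simp [dirac_withDensity]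
  · have hv' : (0 : ℝ) < v := by exact_mod_cast pos_iff_ne_zero.2 hv
    rw [gaussianReal_of_var_ne_zero _ hv, gaussianReal_of_var_ne_zero _ hv,
      ← withDensity_mul _ (measurable_gaussianPDF _ _) (by fun_prop),
      ← withDensity_smul _ (measurable_gaussianPDF _ _)]
    congr 1
    funext u
    simp only [Pi.mul_apply, Pi.smul_apply, smul_eq_mul, gaussianPDF]
    rw [← ENNReal.ofReal_mul (gaussianPDFReal_nonneg _ _ _), ← ENNReal.ofReal_mul (Real.exp_nonneg _)]
    congr 1
    simp only [gaussianPDFReal]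
    rw [mul_assoc, ← Real.exp_add, mul_left_comm, ← Real.exp_add]
    congr 2
    field_simp
    ring

/-- Multiplying a real Gaussian law by a Gaussian weight gives a multiple of a Gaussian law. -/
lemma gaussianReal_withDensity_exp_sq (a : ℝ) (v : ℝ≥0) (q : ℝ≥0) (h : ℝ) :
    (gaussianReal a v).withDensity (fun u => ENNReal.ofReal (Real.exp (-(q * (u - h) ^ 2 / 2))))
      = ENNReal.ofReal ((√(1 + q * v))⁻¹ * Real.exp (-(q * (a - h) ^ 2 / (2 * (1 + q * v)))))
        • gaussianReal ((a + q * v * h) / (1 + q * v)) (v / (1 + q * v)) := by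
  rcases eq_or_ne v 0 with rfl | hv
  · simp [dirac_withDensity]
  · have hv' : (0 : ℝ) < v := by exact_mod_cast pos_iff_ne_zero.2 hv
    have hw : v / (1 + q * v) ≠ 0 := div_ne_zero hv (by positivity)
    rw [gaussianReal_of_var_ne_zero _ hv, gaussianReal_of_var_ne_zero _ hw,
      ← withDensity_mul _ (measurable_gaussianPDF _ _) (by fun_prop),
      ← withDensity_smul _ (measurable_gaussianPDF _ _)]
    congr 1
    funext u
    simp only [Pi.mul_apply, Pi.smul_apply, smul_eq_mul, gaussianPDF]
    rw [← ENNReal.ofReal_mul (gaussianPDFReal_nonneg _ _ _), ← ENNReal.ofReal_mul (by positivity)]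
    congr 1
    simp only [gaussianPDFReal]
    have hd : (0 : ℝ) < 1 + q * v := by positivity
    have e1 : √(2 * Real.pi * ((v / (1 + q * v) : ℝ≥0) : ℝ)) = √(2 * Real.pi * v) * (√(1 + q * v))⁻¹ := by
      rw [← Real.sqrt_inv, ← Real.sqrt_mul (by positivity)]
      congr 1
      push_cast
      field_simp
    rw [e1, mul_assoc, ← Real.exp_add, mul_inv, inv_inv]
    rw [show ∀ A B C D : ℝ, A⁻¹ * C * (B * A * D) = (A⁻¹ * A) * B * (C * D) by intros; ring,
      inv_mul_cancel₀ (by positivity), one_mul, ← Real.exp_add]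
    congr 2
    push_cast
    field_simp
    ring


variable {ι : Type*} [Fintype ι]

lemma memLp_two_eval (γ : Measure (ι → ℝ)) [IsGaussian γ] (i : ι) : MemLp (fun x => x i) 2 γ :=
  IsGaussian.memLp_dual γ (ContinuousLinearMap.proj (R := ℝ) (φ := fun _ : ι => ℝ) i) 2 (by simp)

lemma integrable_eval (γ : Measure (ι → ℝ)) [IsGaussian γ] (i : ι) : Integrable (fun x => x i) γ :=
  (memLp_two_eval γ i).integrable (by simp)

/-- The law of `r + u k` for independent `r` and `u`. -/
lemma mean_cov_map_add_smul (α : Measure (ι → ℝ)) [IsProbabilityMeasure α]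
    (β : Measure ℝ) [IsProbabilityMeasure β] (k : ι → ℝ)
    (hα : ∀ i, MemLp (fun x => x i) 2 α) (hβ : MemLp (fun u => u) 2 β) :
    (∀ i, ∫ x, x i ∂((α.prod β).map (fun p => p.1 + p.2 • k))
        = ∫ x, x i ∂α + k i * ∫ u, u ∂β) ∧
    ∀ i j, cov[fun x => x i, fun x => x j; (α.prod β).map (fun p => p.1 + p.2 • k)]
        = cov[fun x => x i, fun x => x j; α] + k i * k j * Var[fun u => u; β] := by
  have m1 : ∀ i, MemLp (fun p : (ι → ℝ) × ℝ => p.1 i) 2 (α.prod β) := fun i =>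
    (hα i).comp_fst β
  have m2 : MemLp (fun p : (ι → ℝ) × ℝ => p.2) 2 (α.prod β) := hβ.comp_snd α
  have m3 : ∀ i, MemLp (fun p : (ι → ℝ) × ℝ => p.2 * k i) 2 (α.prod β) := fun i =>
    m2.mul_const (k i)
  have hS : Measurable (fun p : (ι → ℝ) × ℝ => p.1 + p.2 • k) := by fun_prop
  refine ⟨fun i => ?_, fun i j => ?_⟩
  · rw [integral_map hS.aemeasurable (measurable_pi_apply i).aestronglyMeasurable]
    simp only [Pi.add_apply, Pi.smul_apply, smul_eq_mul]
    rw [integral_add ((m1 i).integrable (by simp)) ((m3 i).integrable (by simp)),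
      integral_fun_fst (fun x : ι → ℝ => x i), integral_fun_snd (fun u : ℝ => u * k i),
      integral_mul_const]
    simp [mul_comm]
  · rw [covariance_map_fun (measurable_pi_apply i).aestronglyMeasurable
      (measurable_pi_apply j).aestronglyMeasurable hS.aemeasurable]
    simp only [Pi.add_apply, Pi.smul_apply, smul_eq_mul]
    have e1 : cov[fun p : (ι → ℝ) × ℝ => p.1 i, fun p => p.1 j; α.prod β]
        = cov[fun x => x i, fun x => x j; α] := by
      conv_rhs => rw [← Measure.fst_prod (μ := α) (ν := β), Measure.fst]
      rw [covariance_map_fun (measurable_pi_apply i).aestronglyMeasurable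
      (measurable_pi_apply j).aestronglyMeasurable measurable_fst.aemeasurable]
    have e2 : cov[fun p : (ι → ℝ) × ℝ => p.2, fun p => p.2; α.prod β] = Var[fun u => u; β] := by
      rw [← covariance_self (by fun_prop)]
      conv_rhs => rw [← Measure.snd_prod (μ := α) (ν := β), Measure.snd]
      rw [covariance_map_fun (by fun_prop) (by fun_prop) measurable_snd.aemeasurable]
    have e3 : ∀ i, cov[fun p : (ι → ℝ) × ℝ => p.1 i, fun p => p.2; α.prod β] = 0 := fun i =>
      covariance_fst_snd_prod (hα i) hβ
    have e4 : ∀ i, cov[fun p : (ι → ℝ) × ℝ => p.2, fun p => p.1 i; α.prod β] = 0 := fun i => by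
      rw [covariance_comm, e3]
    change cov[(fun p : (ι → ℝ) × ℝ => p.1 i) + (fun p => p.2 * k i),
      (fun p : (ι → ℝ) × ℝ => p.1 j) + (fun p => p.2 * k j); α.prod β] = _
    rw [covariance_add_left (m1 i) (m3 i) ((m1 j).add (m3 j)),
      covariance_add_right (m1 i) (m1 j) (m3 j), covariance_add_right (m3 i) (m1 j) (m3 j),
      covariance_mul_const_right, covariance_mul_const_left, covariance_mul_const_left,
      covariance_mul_const_right, e1, e2, e3, e4]
    ring

/-- The linear functional with coefficients `c`. -/
noncomputable def linForm (c : ι → ℝ) : (ι → ℝ) →L[ℝ] ℝ :=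
  ∑ i, c i • ContinuousLinearMap.proj (R := ℝ) (φ := fun _ : ι => ℝ) i

@[simp] lemma linForm_apply (c x : ι → ℝ) : linForm c x = ∑ i, c i * x i := by
  simp [linForm]

/-- Weighting a Gaussian law by a function of a linear functional `ℓ` which turns the law of `ℓ`
into a multiple of a Gaussian law gives a multiple of a Gaussian law. -/
lemma exists_isGaussian_withDensity (γ : Measure (ι → ℝ)) [IsGaussian γ] (c : ι → ℝ)
    {φ : ℝ → ℝ≥0∞} (hφm : Measurable φ) {C : ℝ≥0∞} {a' : ℝ} {v' : ℝ≥0}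
    (hφ : (gaussianReal (∫ x, linForm c x ∂γ) Var[linForm c; γ].toNNReal).withDensity φ
      = C • gaussianReal a' v') :
    ∃ γ' : Measure (ι → ℝ), IsGaussian γ' ∧
      γ.withDensity (fun x => φ (linForm c x)) = C • γ' ∧
      (∀ i, ∫ x, x i ∂γ' = ∫ x, x i ∂γ
        + cov[fun x => x i, linForm c; γ] / Var[linForm c; γ] * (a' - ∫ x, linForm c x ∂γ)) ∧
      ∀ i j, cov[fun x => x i, fun x => x j; γ'] = cov[fun x => x i, fun x => x j; γ]
        + cov[fun x => x i, linForm c; γ] / Var[linForm c; γ]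
          * (cov[fun x => x j, linForm c; γ] / Var[linForm c; γ]) * (v' - Var[linForm c; γ]) := by
  set ℓ := linForm c with hℓ
  set v := Var[ℓ; γ] with hv
  -- Regression coefficients on `ℓ`. If `ℓ` has variance zero, division by zero gives `k = 0`; then
  -- `ℓ` is a.s. constant, its covariances vanish and `hkv` still holds.
  set k : ι → ℝ := fun i => cov[fun x => x i, ℓ; γ] / v with hk
  have hℓ2 : MemLp ℓ 2 γ := IsGaussian.memLp_dual γ ℓ 2 (by simp)
  have hkv : ∀ i, k i * v = cov[fun x => x i, ℓ; γ] := by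
    intro i
    rcases eq_or_ne v 0 with h0 | h0
    · have h1 : ℓ =ᵐ[γ] fun _ => ∫ x, ℓ x ∂γ := ae_eq_integral_of_variance_eq_zero hℓ2 h0
      have : cov[fun x => x i, ℓ; γ] = 0 := by
        refine integral_eq_zero_of_ae ?_
        filter_upwards [h1] with x hx
        simp [hx]
      simp [hk, this]
    · simp [hk, h0]
  -- The residual of the regression on `ℓ`: uncorrelated with `ℓ`, hence independent of it by
  -- Gaussianity. The weight then acts on the factor `ℓ` alone in `x = R x + ℓ x • k`.
  let R : (ι → ℝ) →L[ℝ] (ι → ℝ) := ContinuousLinearMap.id ℝ _ - ℓ.smulRight k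
  have hR : ∀ x, R x = x - ℓ x • k := fun x => rfl
  have hRcov : ∀ i, cov[fun x => R x i, ℓ; γ] = 0 := by
    intro i
    have : (fun x => R x i) = (fun x => x i) - fun x => ℓ x * k i := by
      ext x; simp [hR]
    rw [this, covariance_sub_left (memLp_two_eval γ i) (hℓ2.mul_const _) hℓ2,
      covariance_mul_const_left, covariance_self hℓ2.aestronglyMeasurable.aemeasurable, ← hv, ← hkv]
    ring
  have hind : IndepFun R ℓ γ := by
    -- `ℓ` is regarded as a family indexed by `Unit`, to fit the covariance criterion for
    -- independence of two families.
    have hG : HasGaussianLaw (fun x => (fun i => R x i, fun _ : Unit => ℓ x)) γ := by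
      have := (IsGaussian.hasGaussianLaw_id (μ := γ)).map
        (R.prod (ContinuousLinearMap.pi fun _ : Unit => ℓ))
      exact this
    have key : IndepFun (fun x i => R x i) (fun x (_ : Unit) => ℓ x) γ :=
      hG.indepFun_of_covariance_eval (X := fun i x => R x i) (Y := fun _ x => ℓ x)
        (fun i _ => hRcov i)
    exact key.comp (φ := id) (ψ := fun f : Unit → ℝ => f ()) measurable_id (measurable_pi_apply ())
  have hlaw : γ.map ℓ = gaussianReal (∫ x, ℓ x ∂γ) v.toNNReal := IsGaussian.map_eq_gaussianReal ℓ
  have hprod : γ.map (fun x => (R x, ℓ x)) = (γ.map R).prod (γ.map ℓ) :=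
    (indepFun_iff_map_prod_eq_prod_map_map (by fun_prop) (by fun_prop)).1 hind
  have hS : Measurable (fun p : (ι → ℝ) × ℝ => p.1 + p.2 • k) := by fun_prop
  have hγ : γ = ((γ.map R).prod (γ.map ℓ)).map (fun p => p.1 + p.2 • k) := by
    rw [← hprod, Measure.map_map hS (by fun_prop)]
    have : ((fun p : (ι → ℝ) × ℝ => p.1 + p.2 • k) ∘ fun x => (R x, ℓ x)) = id := by
      ext x; simp [hR]
    rw [this, Measure.map_id]
  have hα : ∀ i, MemLp (fun x => x i) 2 (γ.map R) := memLp_two_eval _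
  have hβ : ∀ (a : ℝ) (v : ℝ≥0), MemLp (fun u : ℝ => u) 2 (gaussianReal a v) := fun a v =>
    memLp_id_gaussianReal 2
  have M1 := mean_cov_map_add_smul (γ.map R) (γ.map ℓ) k hα (by rw [hlaw]; exact hβ _ _)
  rw [← hγ, hlaw, integral_id_gaussianReal, variance_fun_id_gaussianReal,
    Real.coe_toNNReal _ (variance_nonneg _ _)] at M1
  have M2 := mean_cov_map_add_smul (γ.map R) (gaussianReal a' v') k hα (hβ _ _)
  rw [integral_id_gaussianReal, variance_fun_id_gaussianReal] at M2
  refine ⟨((γ.map R).prod (gaussianReal a' v')).map (fun p => p.1 + p.2 • k), ?_, ?_, ?_, ?_⟩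
  · let S : ((ι → ℝ) × ℝ) →L[ℝ] (ι → ℝ) := ContinuousLinearMap.fst ℝ _ _
      + (ContinuousLinearMap.snd ℝ (ι → ℝ) ℝ).smulRight k
    exact isGaussian_map S
  · refine Measure.ext_of_lintegral _ fun f hf => ?_
    rw [lintegral_withDensity_eq_lintegral_mul _ (by fun_prop) hf, lintegral_smul_measure,
      lintegral_map hf hS, lintegral_prod _ (by fun_prop), smul_eq_mul,
      ← lintegral_const_mul _ (Measurable.lintegral_prod_right' (ν := gaussianReal a' v')
        (f := fun p : (ι → ℝ) × ℝ => f (p.1 + p.2 • k)) (by fun_prop))]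
    calc ∫⁻ x, ((fun x => φ (ℓ x)) * f) x ∂γ
        = ∫⁻ x, φ (ℓ x) * f (R x + ℓ x • k) ∂γ := by
          simp [hR]
      _ = ∫⁻ p, φ p.2 * f (p.1 + p.2 • k) ∂(γ.map (fun x => (R x, ℓ x))) := by
          rw [lintegral_map (by fun_prop) (by fun_prop)]
      _ = ∫⁻ r, ∫⁻ u, φ u * f (r + u • k) ∂(γ.map ℓ) ∂(γ.map R) := by
          rw [hprod, lintegral_prod _ (by fun_prop)]
      _ = _ := by
          refine lintegral_congr fun r => ?_
          rw [hlaw, ← smul_eq_mul C, ← lintegral_smul_measure, ← hφ,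
            lintegral_withDensity_eq_lintegral_mul _ hφm (by fun_prop)]
          rfl
  · intro i
    rw [M2.1 i, M1.1 i]
    ring
  · intro i j
    rw [M2.2 i j, M1.2 i j]
    ring

end

/-! ### Quadratic and likelihood weights, and the tilted mean. -/

section

variable {ι : Type*}

/-- The quadratic weight `exp(-½ ∑_{i ∈ S} q_i (x_i - h_i)²)`. -/
noncomputable def quadWeight (q : ι → ℝ) (S : Finset ι) (h x : ι → ℝ) : ℝ :=
  Real.exp (-∑ i ∈ S, q i * (x i - h i) ^ 2 / 2)

lemma quadWeight_pos (q : ι → ℝ) (S : Finset ι) (h x : ι → ℝ) : 0 < quadWeight q S h x :=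
  Real.exp_pos _

lemma quadWeight_le_one {q : ι → ℝ} (hq : ∀ i, 0 ≤ q i) (S : Finset ι) (h x : ι → ℝ) :
    quadWeight q S h x ≤ 1 := by
  refine Real.exp_le_one_iff.2 (neg_nonpos.2 (Finset.sum_nonneg fun i _ => ?_))
  have := hq i
  positivity

@[fun_prop]
lemma measurable_quadWeight {α : Type*} [MeasurableSpace α] (q : ι → ℝ) (S : Finset ι)
    {f g : α → ι → ℝ} (hf : Measurable f) (hg : Measurable g) :
    Measurable fun a => quadWeight q S (f a) (g a) := by
  unfold quadWeight
  fun_prop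

lemma quadWeight_insert [DecidableEq ι] (q : ι → ℝ) {S : Finset ι} {i : ι} (hi : i ∉ S)
    (h x : ι → ℝ) : quadWeight q (insert i S) h x
      = quadWeight q S h x * Real.exp (-(q i * (x i - h i) ^ 2 / 2)) := by
  rw [quadWeight, quadWeight, Finset.sum_insert hi, ← Real.exp_add]
  congr 1
  ring

lemma integrable_quadWeight {q : ι → ℝ} (hq : ∀ i, 0 ≤ q i) (S : Finset ι) (h : ι → ℝ)
    (γ : Measure (ι → ℝ)) [IsFiniteMeasure γ] : Integrable (quadWeight q S h) γ := by
  refine Integrable.of_bound (by fun_prop : Measurable _).aestronglyMeasurable 1 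
    (ae_of_all _ fun x => ?_)
  rw [Real.norm_of_nonneg (quadWeight_pos ..).le]
  exact quadWeight_le_one hq S h x

lemma integral_quadWeight_pos {q : ι → ℝ} (hq : ∀ i, 0 ≤ q i) (S : Finset ι) (h : ι → ℝ)
    (γ : Measure (ι → ℝ)) [IsProbabilityMeasure γ] : 0 < ∫ x, quadWeight q S h x ∂γ := by
  rw [integral_pos_iff_support_of_nonneg (fun x => (quadWeight_pos ..).le)
    (integrable_quadWeight hq S h γ)]
  have : Function.support (fun x => quadWeight q S h x) = Set.univ := by
    ext x; simp [(quadWeight_pos q S h x).ne']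
  simp [this]

lemma integral_withDensity_ofReal {α : Type*} [MeasurableSpace α] {γ γ' : Measure α} {w : α → ℝ}
    (hw : Measurable w) (hw0 : ∀ x, 0 ≤ w x) {C : ℝ} (hC : 0 ≤ C)
    (h : γ.withDensity (fun x => ENNReal.ofReal (w x)) = ENNReal.ofReal C • γ') (f : α → ℝ) :
    ∫ x, f x * w x ∂γ = C * ∫ x, f x ∂γ' := by
  have h1 := congrArg (fun m => ∫ x, f x ∂m) h
  rw [integral_smul_measure, ENNReal.toReal_ofReal hC, smul_eq_mul,
    integral_withDensity_eq_integral_toReal_smul (by fun_prop) (by simp)] at h1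
  rw [← h1]
  refine integral_congr_ae (ae_of_all _ fun x => ?_)
  simp [ENNReal.toReal_ofReal (hw0 x), mul_comm]

/-- The mean of the coordinate `i` under the law `γ` weighted by `quadWeight q S h`. -/
noncomputable def tiltMean (q : ι → ℝ) (S : Finset ι) (i : ι) (h : ι → ℝ) (γ : Measure (ι → ℝ)) :
    ℝ :=
  (∫ x, x i * quadWeight q S h x ∂γ) / ∫ x, quadWeight q S h x ∂γ

lemma tiltMean_eq {q : ι → ℝ} (hq : ∀ i, 0 ≤ q i) (S : Finset ι) (i : ι) (h : ι → ℝ)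
    (γ γ' : Measure (ι → ℝ)) [IsProbabilityMeasure γ]
    (H : γ.withDensity (fun x => ENNReal.ofReal (quadWeight q S h x))
          = ENNReal.ofReal (∫ x, quadWeight q S h x ∂γ) • γ') :
    tiltMean q S i h γ = ∫ x, x i ∂γ' := by
  have h0 := integral_quadWeight_pos hq S h γ
  rw [tiltMean, integral_withDensity_ofReal (by fun_prop) (fun x => (quadWeight_pos ..).le) h0.le H,
    mul_div_cancel_left₀ _ h0.ne']

/-- The likelihood weight `exp(∑_{i ∈ S} (z_i (x_i - h_i) - q_i (x_i - h_i)² / 2))`. -/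
noncomputable def likWeight (q : ι → ℝ) (S : Finset ι) (h z x : ι → ℝ) : ℝ :=
  Real.exp (∑ i ∈ S, (z i * (x i - h i) - q i * (x i - h i) ^ 2 / 2))

@[fun_prop]
lemma measurable_likWeight {α : Type*} [MeasurableSpace α] (q : ι → ℝ) (S : Finset ι)
    {f g k : α → ι → ℝ} (hf : Measurable f) (hg : Measurable g) (hk : Measurable k) :
    Measurable fun a => likWeight q S (f a) (g a) (k a) := by
  unfold likWeight
  fun_prop

/-- Covariances of a Gaussian law as a function of two indices. -/
noncomputable def covFun (γ : Measure (ι → ℝ)) (i j : ι) : ℝ :=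
  cov[fun x => x i, fun x => x j; γ]

/-- Comparison of total masses in `gaussianReal_withDensity_exp_sq`, applied to the law of one
coordinate. -/
lemma integral_exp_sq_eval (γ : Measure (ι → ℝ)) [IsGaussian γ] (i : ι) {q : ℝ} (hq : 0 ≤ q)
    (g : ℝ) : ∫ x, Real.exp (-(q * (x i - g) ^ 2 / 2)) ∂γ
      = (√(1 + q * covFun γ i i))⁻¹
        * Real.exp (-(q * (∫ x, x i ∂γ - g) ^ 2 / (2 * (1 + q * covFun γ i i)))) := by
  obtain ⟨q, rfl⟩ : ∃ q' : ℝ≥0, q = q' := ⟨⟨q, hq⟩, rfl⟩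
  have hc : covFun γ i i = Var[fun x : ι → ℝ => x i; γ] :=
    covariance_self (measurable_pi_apply i).aemeasurable
  have hlaw : γ.map (fun x => x i) = gaussianReal (∫ x, x i ∂γ) Var[fun x : ι → ℝ => x i; γ].toNNReal :=
    IsGaussian.map_eq_gaussianReal (ContinuousLinearMap.proj (R := ℝ) (φ := fun _ : ι => ℝ) i)
  have h0 := variance_nonneg (fun x : ι → ℝ => x i) γ
  have := congrArg (fun m => m Set.univ) (gaussianReal_withDensity_exp_sq (∫ x, x i ∂γ)
    Var[fun x : ι → ℝ => x i; γ].toNNReal q g)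
  simp only [withDensity_apply _ MeasurableSet.univ, Measure.restrict_univ, Measure.smul_apply,
    measure_univ, smul_eq_mul, mul_one] at this
  rw [← hlaw, lintegral_map (by fun_prop) (measurable_pi_apply i)] at this
  rw [integral_eq_lintegral_of_nonneg_ae (ae_of_all _ fun x => (Real.exp_pos _).le)
    (by fun_prop : Measurable _).aestronglyMeasurable, hc]
  simp only [Real.coe_toNNReal _ h0] at this
  rw [this, ENNReal.toReal_ofReal (by positivity)]

variable [Fintype ι]

/-- Tilting a Gaussian law by the exponential of a linear functional `ℓ` shifts the mean by the
covariance with `ℓ` and leaves the covariances unchanged. -/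
lemma exists_isGaussian_withDensity_exp (γ : Measure (ι → ℝ)) [IsGaussian γ] (c : ι → ℝ) :
    ∃ γ' : Measure (ι → ℝ), IsGaussian γ' ∧ ∃ C : ℝ, 0 < C ∧
      γ.withDensity (fun x => ENNReal.ofReal (Real.exp (linForm c x))) = ENNReal.ofReal C • γ' ∧
      (∀ i, ∫ x, x i ∂γ' = ∫ x, x i ∂γ + cov[fun x => x i, linForm c; γ]) ∧
      ∀ i j, cov[fun x => x i, fun x => x j; γ'] = cov[fun x => x i, fun x => x j; γ] := by
  have hℓ2 : MemLp (linForm c) 2 γ := IsGaussian.memLp_dual γ (linForm c) 2 (by simp)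
  obtain ⟨γ', h1, h2, h3, h4⟩ := exists_isGaussian_withDensity γ c
    (φ := fun u => ENNReal.ofReal (Real.exp u)) (by fun_prop)
    (gaussianReal_withDensity_exp _ _)
  rw [Real.coe_toNNReal _ (variance_nonneg _ _)] at h3 h4
  refine ⟨γ', h1, _, Real.exp_pos _, h2, fun i => ?_, fun i j => ?_⟩
  · rw [h3 i]
    rcases eq_or_ne Var[linForm c; γ] 0 with h0 | h0
    · have h1 := ae_eq_integral_of_variance_eq_zero hℓ2 h0
      have : cov[fun x => x i, linForm c; γ] = 0 := by
        refine integral_eq_zero_of_ae ?_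
        filter_upwards [h1] with x hx
        simp only [hx, sub_self, mul_zero, Pi.zero_apply]
      simp [this]
    · field_simp
      ring
  · rw [h4 i j]; ring

/-- A quadratic weight turns a Gaussian law into a multiple of a Gaussian law, whose covariances
depend only on those of the original law. -/
lemma exists_isGaussian_withDensity_quadWeight {q : ι → ℝ} (hq : ∀ i, 0 ≤ q i) (S : Finset ι) :
    ∃ Φ : (ι → ι → ℝ) → (ι → ι → ℝ), ∀ (γ : Measure (ι → ℝ)) [IsGaussian γ] (h : ι → ℝ),
      ∃ γ' : Measure (ι → ℝ), IsGaussian γ' ∧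
        γ.withDensity (fun x => ENNReal.ofReal (quadWeight q S h x))
          = ENNReal.ofReal (∫ x, quadWeight q S h x ∂γ) • γ' ∧ covFun γ' = Φ (covFun γ) := by
  classical
  obtain ⟨q, rfl⟩ : ∃ q' : ι → ℝ≥0, q = fun i => (q' i : ℝ) := ⟨fun i => ⟨q i, hq i⟩, rfl⟩
  -- The multiplicative constant may be left unspecified: `γ'` is a probability measure, so
  -- evaluating on the whole space identifies it.
  suffices H : ∃ Φ : (ι → ι → ℝ) → (ι → ι → ℝ), ∀ (γ : Measure (ι → ℝ)) [IsGaussian γ] (h : ι → ℝ),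
      ∃ γ' : Measure (ι → ℝ), IsGaussian γ' ∧ ∃ C : ℝ≥0∞,
        γ.withDensity (fun x => ENNReal.ofReal (quadWeight (fun i => (q i : ℝ)) S h x)) = C • γ' ∧
          covFun γ' = Φ (covFun γ) by
    obtain ⟨Φ, H⟩ := H
    refine ⟨Φ, fun γ _ h => ?_⟩
    obtain ⟨γ', h1, C, h2, h3⟩ := H γ h
    refine ⟨γ', h1, ?_, h3⟩
    have := congrArg (fun m => m Set.univ) h2
    simp only [withDensity_apply _ MeasurableSet.univ, Measure.restrict_univ, Measure.smul_apply,
      measure_univ, smul_eq_mul, mul_one] at this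
    rw [h2, ← this, ofReal_integral_eq_lintegral_ofReal (integrable_quadWeight hq S h γ)
      (ae_of_all _ fun x => (quadWeight_pos ..).le)]
  induction S using Finset.induction_on with
  | empty => exact ⟨id, fun γ _ h => ⟨γ, inferInstance, 1, by simp [quadWeight], rfl⟩⟩
  | insert i S hi ih =>
    obtain ⟨Φ, H⟩ := ih
    -- The rank-one covariance update of `exists_isGaussian_withDensity` for `ℓ = x_i`, whose
    -- variance passes from `v` to `v / (1 + q_i v)`. Neither `h` nor the mean enters, so the update
    -- is a function of the covariances alone.
    refine ⟨fun K j l => Φ K j l + Φ K j i / Φ K i i * (Φ K l i / Φ K i i)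
      * (Φ K i i / (1 + q i * Φ K i i) - Φ K i i), fun γ _ h => ?_⟩
    obtain ⟨γ₁, h1, C, h2, h3⟩ := H γ h
    have hlin : ∀ x : ι → ℝ, linForm (Pi.single i 1) x = x i := fun x => by
      simp [Pi.single_apply]
    have hlin' : ⇑(linForm (Pi.single i (1 : ℝ))) = fun x => x i := funext hlin
    have hvar : Var[fun x : ι → ℝ => x i; γ₁] = Φ (covFun γ) i i := by
      rw [← h3, covFun, covariance_self (measurable_pi_apply i).aemeasurable]
    have hvar0 : 0 ≤ Φ (covFun γ) i i := hvar ▸ variance_nonneg _ _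
    obtain ⟨γ', g1, g2, -, g4⟩ := exists_isGaussian_withDensity γ₁ (Pi.single i 1)
      (φ := fun u => ENNReal.ofReal (Real.exp (-(q i * (u - h i) ^ 2 / 2))))
      (by fun_prop) (gaussianReal_withDensity_exp_sq _ _ _ _)
    obtain ⟨D, g2⟩ : ∃ D : ℝ≥0∞, γ₁.withDensity (fun x => ENNReal.ofReal
      (Real.exp (-(q i * (linForm (Pi.single i 1) x - h i) ^ 2 / 2)))) = D • γ' := ⟨_, g2⟩
    refine ⟨γ', g1, C * D, ?_, ?_⟩
    · rw [mul_smul, ← g2, ← withDensity_smul_measure, ← h2,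
        ← withDensity_mul _ (by fun_prop) (by fun_prop)]
      congr 1
      funext x
      rw [quadWeight_insert _ hi, Pi.mul_apply, ENNReal.ofReal_mul (quadWeight_pos ..).le, hlin]
    · funext j l
      have := g4 j l
      rw [hlin', hvar] at this
      simp only [covFun] at h3 ⊢
      rw [this, ← h3]
      simp only [NNReal.coe_div, NNReal.coe_add, NNReal.coe_one, NNReal.coe_mul]
      rw [Real.coe_toNNReal _ (by rw [h3]; exact hvar0)]
      simp only [covFun]

/-- Integrating out one further Gaussian weight. The resulting constant depends on the Gaussian law
only through its covariances. -/
lemma exists_integral_quadWeight_mul {q : ι → ℝ} (hq : ∀ i, 0 ≤ q i) (S : Finset ι) (i : ι) :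
    ∃ V : (ι → ι → ℝ) → ℝ, ∀ (γ : Measure (ι → ℝ)) [IsGaussian γ] (h : ι → ℝ) (g : ℝ),
      0 ≤ V (covFun γ) ∧
      ∫ x, quadWeight q S h x * Real.exp (-(q i * (x i - g) ^ 2 / 2)) ∂γ
        = (∫ x, quadWeight q S h x ∂γ) * ((√(1 + q i * V (covFun γ)))⁻¹
          * Real.exp (-(q i * (tiltMean q S i h γ - g) ^ 2 / (2 * (1 + q i * V (covFun γ)))))) := by
  obtain ⟨Φ, H⟩ := exists_isGaussian_withDensity_quadWeight hq S
  -- The variance of `x_i` under the law already weighted over `S`.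
  refine ⟨fun K => Φ K i i, fun γ _ h g => ?_⟩
  obtain ⟨γ', h1, h2, h3⟩ := H γ h
  have h0 := integral_quadWeight_pos hq S h γ
  beta_reduce
  rw [← h3]
  refine ⟨?_, ?_⟩
  · rw [covFun, covariance_self (measurable_pi_apply i).aemeasurable]
    exact variance_nonneg _ _
  · rw [tiltMean_eq hq S i h γ γ' h2, ← integral_exp_sq_eval γ' i (hq i) g,
      ← integral_withDensity_ofReal (by fun_prop) (fun x => (quadWeight_pos ..).le) h0.le h2]
    simp_rw [mul_comm]

/-- Under the likelihood-weighted law the mean of `x_i` minus its covariance with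
`ξ = ∑ z_j (x_j - h_j)` does not depend on `z`. -/
lemma mean_sub_cov_likWeight {q : ι → ℝ} (hq : ∀ i, 0 ≤ q i) (S : Finset ι) (i : ι)
    (h z : ι → ℝ) (γ : Measure (ι → ℝ)) [IsGaussian γ] (ν : Measure (ι → ℝ))
    [IsProbabilityMeasure ν] (D : ℝ≥0∞)
    (hν : D • ν = γ.withDensity (fun x => ENNReal.ofReal (likWeight q S h z x))) (c : ℝ) :
    ∫ x, x i ∂ν - ∫ x, (x i - ∫ y, y i ∂ν) * (∑ j ∈ S, (x j - h j) * z j - c) ∂ν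
      = tiltMean q S i h γ := by
  classical
  obtain ⟨Φ, H⟩ := exists_isGaussian_withDensity_quadWeight hq S
  obtain ⟨γ', h1, h2, h3⟩ := H γ h
  have h0 := integral_quadWeight_pos hq S h γ
  rw [tiltMean_eq hq S i h γ γ' h2]
  -- `ξ` differs from `linForm b` by a constant only, so both have the same covariances.
  set b : ι → ℝ := fun j => if j ∈ S then z j else 0 with hb
  have hbsum : ∀ x : ι → ℝ, linForm b x = ∑ j ∈ S, z j * x j := fun x => by
    simp [hb, Finset.sum_ite_mem]
  obtain ⟨ν', g1, C, hC, g2, g3, g4⟩ := exists_isGaussian_withDensity_exp γ' b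
  obtain ⟨E, hE⟩ : ∃ E : ℝ, E = Real.exp (-∑ j ∈ S, z j * h j) := ⟨_, rfl⟩
  have hE0 : 0 < E := hE ▸ Real.exp_pos _
  have hlik : ∀ x, likWeight q S h z x
      = E * (quadWeight q S h x * Real.exp (linForm b x)) := fun x => by
    rw [likWeight, quadWeight, hE, hbsum, ← Real.exp_add, ← Real.exp_add, ← Finset.sum_neg_distrib,
      ← Finset.sum_neg_distrib, ← Finset.sum_add_distrib, ← Finset.sum_add_distrib]
    congr 1
    exact Finset.sum_congr rfl fun j _ => by ring
  have key : ∃ D' : ℝ≥0∞, D' ≠ 0 ∧ D' ≠ ∞ ∧ D • ν = D' • ν' := by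
    refine ⟨ENNReal.ofReal E * (ENNReal.ofReal (∫ x, quadWeight q S h x ∂γ) * ENNReal.ofReal C),
      by positivity, by finiteness, ?_⟩
    rw [mul_smul, mul_smul, ← g2, ← withDensity_smul_measure, ← h2,
      ← withDensity_mul _ (by fun_prop) (by fun_prop), ← withDensity_smul _ (by fun_prop), hν]
    congr 1
    funext x
    simp only [Pi.smul_apply, Pi.mul_apply, smul_eq_mul]
    rw [hlik, ENNReal.ofReal_mul hE0.le, ENNReal.ofReal_mul (quadWeight_pos ..).le]
  -- Both are probability measures proportional to the same finite nonzero measure.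
  have hνν : ν = ν' := by
    obtain ⟨D', hD0, hDt, hD⟩ := key
    have hDD : D = D' := by
      have := congrArg (fun m => m Set.univ) hD
      simpa using this
    have : ν = D'⁻¹ • (D' • ν) := by rw [smul_smul, ENNReal.inv_mul_cancel hD0 hDt, one_smul]
    rw [this, ← hDD, hD, hDD, smul_smul, ENNReal.inv_mul_cancel hD0 hDt, one_smul]
  have m1 := memLp_two_eval ν'
  have m2 : MemLp (linForm b) 2 ν' := IsGaussian.memLp_dual ν' (linForm b) 2 (by simp)
  -- The exponential tilt from `γ'` to `ν'` preserves covariances: the term subtracted under `ν'`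
  -- equals the mean shift computed under `γ'`.
  have hcov : cov[fun x => x i, linForm b; ν'] = cov[fun x => x i, linForm b; γ'] := by
    have e : ⇑(linForm b) = fun x : ι → ℝ => ∑ j, b j * x j := funext fun x => linForm_apply b x
    rw [e, covariance_fun_sum_right (fun j => (m1 j).const_mul _) (m1 i),
      covariance_fun_sum_right (fun j => (memLp_two_eval γ' j).const_mul _) (memLp_two_eval γ' i)]
    refine Finset.sum_congr rfl fun j _ => ?_
    rw [covariance_const_mul_right, covariance_const_mul_right, g4]
  have hint : ∫ x, (x i - ∫ y, y i ∂ν') * (∑ j ∈ S, (x j - h j) * z j - c) ∂ν'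
      = cov[fun x => x i, linForm b; ν'] := by
    -- All constants, including the arbitrary centring `c`, are collected in `d`; it multiplies a
    -- variable of mean zero and drops out.
    set d := ∫ x, linForm b x ∂ν' - ∑ j ∈ S, z j * h j - c with hd
    have e : ∀ x : ι → ℝ, (x i - ∫ y, y i ∂ν') * (∑ j ∈ S, (x j - h j) * z j - c)
        = (x i - ∫ y, y i ∂ν') * (linForm b x - ∫ y, linForm b y ∂ν')
          + (x i - ∫ y, y i ∂ν') * d := fun x => by
      have : ∑ j ∈ S, (x j - h j) * z j = linForm b x - ∑ j ∈ S, z j * h j := by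
        rw [hbsum, ← Finset.sum_sub_distrib]
        exact Finset.sum_congr rfl fun j _ => by ring
      rw [this, hd]; ring
    simp_rw [e]
    have i1 : MemLp (fun x : ι → ℝ => x i - ∫ y, y i ∂ν') 2 ν' := (m1 i).sub (memLp_const _)
    have i2 : MemLp (fun x : ι → ℝ => linForm b x - ∫ y, linForm b y ∂ν') 2 ν' :=
      m2.sub (memLp_const _)
    rw [integral_add (f := fun x => (x i - ∫ y, y i ∂ν') * (linForm b x - ∫ y, linForm b y ∂ν'))
      (i1.integrable_mul i2) ((i1.integrable (by simp)).mul_const _),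
      integral_mul_const, integral_sub ((m1 i).integrable (by simp)) (integrable_const _)]
    simp [covariance]
  rw [hνν, hint, hcov, g3 i]
  ring

end

/-! ### Bayes' formula for the augmented observations. -/

section

/-- The reference law `N(0, q)` does not depend on the signal `u`, so one measure dominates the
observation laws for all signals. At `q = 0` both sides are the Dirac mass at `0`. -/
lemma gaussianReal_zero_withDensity (q : ℝ≥0) (u : ℝ) :
    (gaussianReal 0 q).withDensity (fun z => ENNReal.ofReal (Real.exp (z * u - q * u ^ 2 / 2)))
      = gaussianReal (q * u) q := by
  rcases eq_or_ne q 0 with rfl | hv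
  · simp [dirac_withDensity]
  · have hv' : (0 : ℝ) < q := by exact_mod_cast pos_iff_ne_zero.2 hv
    rw [gaussianReal_of_var_ne_zero _ hv, gaussianReal_of_var_ne_zero _ hv,
      ← withDensity_mul _ (measurable_gaussianPDF _ _) (by fun_prop)]
    congr 1
    funext z
    simp only [Pi.mul_apply, gaussianPDF]
    rw [← ENNReal.ofReal_mul (gaussianPDFReal_nonneg _ _ _)]
    congr 1
    simp only [gaussianPDFReal]
    rw [mul_assoc, ← Real.exp_add]
    congr 2
    field_simp
    ring

/-- The density of a product of laws with densities. -/
lemma pi_withDensity {κ : Type*} [Fintype κ] (ν : κ → Measure ℝ) [∀ i, IsProbabilityMeasure (ν i)]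
    {f : κ → ℝ → ℝ≥0∞} (hf : ∀ i, Measurable (f i))
    [∀ i, SigmaFinite ((ν i).withDensity (f i))] :
    (Measure.pi ν).withDensity (fun z => ∏ i, f i (z i))
      = Measure.pi (fun i => (ν i).withDensity (f i)) := by
  refine (Measure.pi_eq fun s hs => ?_).symm
  rw [withDensity_apply _ (MeasurableSet.univ_pi hs), ← lintegral_indicator (MeasurableSet.univ_pi hs)]
  have e : ((Set.univ.pi s).indicator fun z => ∏ i, f i (z i))
      = fun z => ∏ i, (s i).indicator (f i) (z i) := by
    funext z
    by_cases hz : z ∈ Set.univ.pi s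
    · rw [Set.indicator_of_mem hz]
      exact Finset.prod_congr rfl fun i _ => (Set.indicator_of_mem (hz i trivial) _).symm
    · rw [Set.indicator_of_notMem hz]
      obtain ⟨i, hi⟩ : ∃ i, z i ∉ s i := by simpa using hz
      exact (Finset.prod_eq_zero (Finset.mem_univ i) (Set.indicator_of_notMem hi _)).symm
  have hm : ∀ i, Measurable ((s i).indicator (f i)) := fun i => (hf i).indicator (hs i)
  rw [e, lintegral_prod_eq_prod_lintegral_of_indepFun Finset.univ
    (fun i (z : κ → ℝ) => (s i).indicator (f i) (z i))
    (iIndepFun_pi (μ := ν) fun i => (hm i).aemeasurable)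
    (fun i => (hm i).comp (measurable_pi_apply i))]
  refine Finset.prod_congr rfl fun i _ => ?_
  rw [withDensity_apply _ (hs i), ← lintegral_indicator (hs i),
    ← (measurePreserving_eval ν i).lintegral_comp (hm i)]

/-- The law of the auxiliary observations for given values `u` of the errors. -/
lemma map_pi_gaussianReal {κ : Type*} [Fintype κ] {q : κ → ℝ} (hq : ∀ i, 0 ≤ q i) (u : κ → ℝ) :
    (Measure.pi fun _ : κ => gaussianReal 0 1).map (fun e i => q i * u i + √(q i) * e i)
      = (Measure.pi fun i => gaussianReal 0 (q i).toNNReal).withDensity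
        (fun z => ENNReal.ofReal (Real.exp (∑ i, (z i * u i - q i * u i ^ 2 / 2)))) := by
  obtain ⟨q, rfl⟩ : ∃ q' : κ → ℝ≥0, q = fun i => (q' i : ℝ) := ⟨fun i => ⟨q i, hq i⟩, rfl⟩
  have h1 : ∀ i, (gaussianReal 0 (q i)).withDensity
      (fun z => ENNReal.ofReal (Real.exp (z * u i - q i * u i ^ 2 / 2)))
        = gaussianReal (q i * u i) (q i) := fun i => gaussianReal_zero_withDensity _ _
  have inst : ∀ i, SigmaFinite ((gaussianReal 0 (q i)).withDensity
      (fun z => ENNReal.ofReal (Real.exp (z * u i - q i * u i ^ 2 / 2)))) := fun i => by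
    rw [h1]; infer_instance
  simp_rw [Real.exp_sum, ENNReal.ofReal_prod_of_nonneg (fun i _ => (Real.exp_pos _).le),
    Real.toNNReal_coe]
  rw [pi_withDensity (fun i => gaussianReal 0 (q i))
    (f := fun i z => ENNReal.ofReal (Real.exp (z * u i - q i * u i ^ 2 / 2))) (fun i => by fun_prop),
    Measure.pi_map_pi (f := fun i e => q i * u i + √(q i) * e) (fun i => by fun_prop)]
  congr 1
  funext i
  rw [h1, show (fun e : ℝ => (q i : ℝ) * u i + √(q i) * e)
    = (fun x => q i * u i + x) ∘ (fun e => √(q i) * e) from rfl,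
    ← Measure.map_map (by fun_prop) (by fun_prop), gaussianReal_map_const_mul,
    gaussianReal_map_const_add]
  congr 1
  · simp
  · ext; simp

variable {Ω : Type*} [MeasurableSpace Ω]

/-- The mean of the regular conditional distribution of `f(W, X)` given `W`. -/
lemma regCondExp_comp {β E : Type*} [MeasurableSpace β] [MeasurableSpace E] [StandardBorelSpace E]
    [Nonempty E] (P : Measure Ω) [IsFiniteMeasure P] {W : Ω → β} {X : Ω → E} (hW : Measurable W)
    (hX : Measurable X) {f : β × E → ℝ} (hf : Measurable f) :
    ∀ᵐ w ∂(P.map W), ∫ u, u ∂(condDistrib (fun ω => f (W ω, X ω)) W P w)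
      = ∫ e, f (w, e) ∂(condDistrib X W P w) := by
  -- The identity holds between the laws themselves, so no integrability of `f(W, X)` is needed.
  have h : condDistrib (fun ω => f (W ω, X ω)) W P
      =ᵐ[P.map W] (Kernel.id ×ₖ condDistrib X W P).map f := by
    refine condDistrib_ae_eq_of_measure_eq_compProd W (by fun_prop) ?_
    refine Measure.ext_of_lintegral _ fun g hg => ?_
    rw [lintegral_map hg (by fun_prop), Measure.lintegral_compProd hg]
    have e1 : ∀ b, ∫⁻ u, g (b, u) ∂((Kernel.id ×ₖ condDistrib X W P).map f b)
        = ∫⁻ e, g (b, f (b, e)) ∂(condDistrib X W P b) := fun b => by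
      rw [Kernel.lintegral_map _ hf _ (by fun_prop),
        Kernel.lintegral_id_prod (f := fun p => g (b, f p)) (by fun_prop)]
    simp_rw [e1]
    rw [← Measure.lintegral_compProd (f := fun p => g (p.1, f p)) (by fun_prop),
      compProd_map_condDistrib hX.aemeasurable, lintegral_map (by fun_prop) (by fun_prop)]
  filter_upwards [h] with w hw
  rw [hw, Kernel.map_apply _ hf, integral_map hf.aemeasurable (by fun_prop),
    Kernel.prod_apply, Kernel.id_apply, Measure.dirac_prod, integral_map (by fun_prop) (by fun_prop)]

/-- **Bayes' formula** for the conditional distribution of `X` given `(Y, Z)` when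
`Z = T(Y, X, e)` with `e` independent of `(Y, X)`. -/
lemma condDistrib_withDensity {B E Z G : Type*} [MeasurableSpace B] [MeasurableSpace E]
    [StandardBorelSpace E] [Nonempty E] [MeasurableSpace Z] [MeasurableSpace G]
    (P : Measure Ω) [IsProbabilityMeasure P] {Y : Ω → B} {X : Ω → E} {e : Ω → G}
    (hY : Measurable Y) (hX : Measurable X) (he : Measurable e)
    (hind : IndepFun (fun ω => (Y ω, X ω)) e P) {T : (B × E) × G → Z} (hT : Measurable T)
    (ρ : Measure Z) [IsProbabilityMeasure ρ] {L : (B × Z) × E → ℝ≥0∞} (hL : Measurable L)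
    (hL0 : ∀ p, L p ≠ 0)
    (hlaw : ∀ p : B × E, (P.map e).map (fun g => T (p, g))
      = ρ.withDensity (fun z => L ((p.1, z), p.2))) :
    ∀ᵐ w ∂(P.map fun ω => (Y ω, T ((Y ω, X ω), e ω))),
      ∃ D : ℝ≥0∞, D • condDistrib X (fun ω => (Y ω, T ((Y ω, X ω), e ω))) P w
        = (condDistrib X Y P w.1).withDensity (fun x => L (w, x)) := by
  set W : Ω → B × Z := fun ω => (Y ω, T ((Y ω, X ω), e ω)) with hWdef
  have hW : Measurable W := by fun_prop
  set κ := condDistrib X Y P with hκ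
  have : IsProbabilityMeasure (P.map e) := Measure.isProbabilityMeasure_map he.aemeasurable
  have : IsProbabilityMeasure (P.map Y) := Measure.isProbabilityMeasure_map hY.aemeasurable
  have : IsProbabilityMeasure (P.map W) := Measure.isProbabilityMeasure_map hW.aemeasurable
  -- The joint law of `(W, X)` has density `L` with respect to the law under which `Z` is drawn from
  -- `ρ` independently of `(Y, X)`.
  have star : ∀ F : (B × Z) × E → ℝ≥0∞, Measurable F →
      ∫⁻ p, F p ∂(P.map fun ω => (W ω, X ω))
        = ∫⁻ w, ∫⁻ x, L (w, x) * F (w, x) ∂(κ w.1) ∂((P.map Y).prod ρ) := by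
    intro F hF
    have hYX : Measurable fun ω => (Y ω, X ω) := by fun_prop
    have h1 := (indepFun_iff_map_prod_eq_prod_map_map hYX.aemeasurable he.aemeasurable).1 hind
    have hin : ∀ p : B × E, ∫⁻ g, F ((p.1, T (p, g)), p.2) ∂(P.map e)
        = ∫⁻ z, L ((p.1, z), p.2) * F ((p.1, z), p.2) ∂ρ := fun p => by
      rw [← lintegral_map (f := fun z => F ((p.1, z), p.2)) (g := fun g => T (p, g)) (by fun_prop)
        (by fun_prop), hlaw p, lintegral_withDensity_eq_lintegral_mul _ (by fun_prop) (by fun_prop)]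
      rfl
    calc ∫⁻ p, F p ∂(P.map fun ω => (W ω, X ω))
        = ∫⁻ r, F ((r.1.1, T r), r.1.2) ∂(P.map fun ω => ((Y ω, X ω), e ω)) := by
          rw [lintegral_map hF (by fun_prop), lintegral_map (by fun_prop) (by fun_prop)]
      _ = ∫⁻ p, ∫⁻ z, L ((p.1, z), p.2) * F ((p.1, z), p.2) ∂ρ ∂(P.map fun ω => (Y ω, X ω)) := by
          rw [h1, lintegral_prod _ (by fun_prop)]
          simp_rw [hin]
      _ = ∫⁻ y, ∫⁻ x, ∫⁻ z, L ((y, z), x) * F ((y, z), x) ∂ρ ∂(κ y) ∂(P.map Y) := by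
          rw [← compProd_map_condDistrib hX.aemeasurable, Measure.lintegral_compProd]
          exact Measurable.lintegral_prod_right'
            (f := fun r : (B × E) × Z => L ((r.1.1, r.2), r.1.2) * F ((r.1.1, r.2), r.1.2))
            (by fun_prop)
      _ = ∫⁻ y, ∫⁻ z, ∫⁻ x, L ((y, z), x) * F ((y, z), x) ∂(κ y) ∂ρ ∂(P.map Y) := by
          refine lintegral_congr fun y => ?_
          exact lintegral_lintegral_swap (Measurable.aemeasurable (by fun_prop))
      _ = _ := by
          rw [lintegral_prod]
          refine Measurable.aemeasurable ?_
          exact Measurable.lintegral_kernel_prod_right' (κ := κ.comap Prod.fst measurable_fst)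
            (f := fun r : (B × Z) × E => L r * F r) (by fun_prop)
  set D : B × Z → ℝ≥0∞ := fun w => ∫⁻ x, L (w, x) ∂(κ w.1) with hD
  have hDm : Measurable D := Measurable.lintegral_kernel_prod_right'
    (κ := κ.comap Prod.fst measurable_fst) hL
  have hD0 : ∀ w, D w ≠ 0 := fun w h => by
    rw [hD, lintegral_eq_zero_iff (by fun_prop)] at h
    obtain ⟨x, hx⟩ := h.exists
    exact hL0 _ hx
  have starD : ∀ G : B × Z → ℝ≥0∞, Measurable G →
      ∫⁻ w, G w ∂(P.map W) = ∫⁻ w, D w * G w ∂((P.map Y).prod ρ) := by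
    intro G hG
    have := star (fun p => G p.1) (by fun_prop)
    rw [lintegral_map (by fun_prop) (by fun_prop)] at this
    rw [lintegral_map hG hW, this]
    refine lintegral_congr fun w => ?_
    exact lintegral_mul_const (G w) (f := fun x => L (w, x)) (by fun_prop)
  -- The normalizer `D` has total integral `1` under the reference law, hence is a.e. finite.
  have hDtop : ∀ᵐ w ∂((P.map Y).prod ρ), D w < ∞ := by
    refine ae_lt_top hDm ?_
    have := starD (fun _ => 1) measurable_const
    simp only [mul_one, lintegral_one, measure_univ] at this
    simp [← this]
  have hac : P.map W ≪ (P.map Y).prod ρ := by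
    have : P.map W = ((P.map Y).prod ρ).withDensity D := by
      refine Measure.ext_of_lintegral _ fun G hG => ?_
      rw [starD G hG, lintegral_withDensity_eq_lintegral_mul _ hDm hG]
      rfl
    rw [this]
    exact withDensity_absolutelyContinuous _ _
  let κ₁ : Kernel (B × Z) E := κ.comap Prod.fst measurable_fst
  have hf : Measurable (Function.uncurry fun (w : B × Z) (x : E) => L (w, x) * (D w)⁻¹) := by
    simp only [Function.uncurry_def]
    fun_prop
  let κ' : Kernel (B × Z) E := κ₁.withDensity (fun w x => L (w, x) * (D w)⁻¹)
  have hκ' : ∀ w, κ' w = (κ w.1).withDensity (fun x => L (w, x) * (D w)⁻¹) := fun w =>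
    Kernel.withDensity_apply _ hf w
  have hfin : IsFiniteKernel κ' := by
    refine ⟨1, ENNReal.one_lt_top, fun w => ?_⟩
    rw [hκ', withDensity_apply _ MeasurableSet.univ, Measure.restrict_univ,
      lintegral_mul_const _ (by fun_prop)]
    exact ENNReal.mul_inv_le_one _
  -- The normalized kernel disintegrates the joint law, so a.e. uniqueness of conditional
  -- distributions identifies it.
  have huniq : condDistrib X W P =ᵐ[P.map W] κ' := by
    refine condDistrib_ae_eq_of_measure_eq_compProd W hX.aemeasurable ?_
    refine Measure.ext_of_lintegral _ fun F hF => ?_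
    rw [star F hF, Measure.lintegral_compProd hF, starD _ (Measurable.lintegral_kernel_prod_right' hF)]
    refine lintegral_congr_ae ?_
    filter_upwards [hDtop] with w hw
    rw [hκ', lintegral_withDensity_eq_lintegral_mul _ (by fun_prop) (by fun_prop),
      ← lintegral_const_mul _ (by fun_prop)]
    refine lintegral_congr fun x => ?_
    simp only [Pi.mul_apply]
    rw [show D w * (L (w, x) * (D w)⁻¹ * F (w, x)) = D w * (D w)⁻¹ * (L (w, x) * F (w, x)) by ring,
      ENNReal.mul_inv_cancel (hD0 w) hw.ne, one_mul]
  filter_upwards [huniq, hac.ae_le hDtop] with w hw hwt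
  refine ⟨D w, ?_⟩
  rw [hw, hκ', ← withDensity_smul _ (by fun_prop)]
  congr 1
  funext x
  simp only [Pi.smul_apply, smul_eq_mul]
  rw [mul_comm, mul_assoc, ENNReal.inv_mul_cancel (hD0 w) hwt.ne, mul_one]

end

/-! ### Identification of `Ztilde` with the tilted conditional mean. -/

section

lemma obsSigma_mono {Ω : Type*} (Y : ℕ → Ω → ℝ) {s t : ℕ} (hst : s ≤ t) : obsSigma Y s ≤ obsSigma Y t := by
  let r : (Finset.Icc 1 t → ℝ) → (Finset.Icc 1 s → ℝ) := fun y i =>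
    y ⟨i, Finset.mem_Icc.2 ⟨(Finset.mem_Icc.1 i.2).1, (Finset.mem_Icc.1 i.2).2.trans hst⟩⟩
  have hr : Measurable r := by fun_prop
  have : obsVec Y s = r ∘ obsVec Y t := rfl
  rw [obsSigma, this, ← MeasurableSpace.comap_comp]
  exact MeasurableSpace.comap_mono hr.comap_le

/-- Once `(Y_1, …, Y_t)` is fixed, `h_1, …, h_t` are constants; this makes the Gaussian lemmas
applicable under the conditional law. -/
lemma IsAdapted.exists_eq_comp {Ω : Type*} {Y h : ℕ → Ω → ℝ} (hh : IsAdapted Y h) (t : ℕ) :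
    ∃ H : (Finset.Icc 1 t → ℝ) → (Finset.Icc 1 t → ℝ), Measurable H ∧
      ∀ ω, H (obsVec Y t ω) = obsVec h t ω := by
  have : ∀ i : Finset.Icc 1 t, ∃ G : (Finset.Icc 1 t → ℝ) → ℝ, Measurable G ∧
      h i = G ∘ obsVec Y t := fun i => by
    have h1 : Measurable[obsSigma Y t] (h i) :=
      (hh i (Finset.mem_Icc.1 i.2).1).mono (obsSigma_mono Y (Finset.mem_Icc.1 i.2).2) le_rfl
    exact h1.exists_eq_measurable_comp
  choose G hG hGh using this
  refine ⟨fun y i => G i y, measurable_pi_lambda _ hG, fun ω => ?_⟩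
  funext i
  exact (congrFun (hGh i) ω).symm

variable {Ω : Type*} [MeasurableSpace Ω]

/-- The inclusion of the indices `1, …, t-1` into `1, …, t`. -/
def pastEmb (t : ℕ) : Finset.Icc 1 (t - 1) ↪ Finset.Icc 1 t where
  toFun s := ⟨s, Finset.mem_Icc.2 ⟨(Finset.mem_Icc.1 s.2).1,
    (Finset.mem_Icc.1 s.2).2.trans (Nat.sub_le t 1)⟩⟩
  inj' _ _ h := Subtype.ext (congrArg (fun i : Finset.Icc 1 t => (i : ℕ)) h)

@[simp] lemma pastEmb_coe (t : ℕ) (s : Finset.Icc 1 (t - 1)) : (pastEmb t s : ℕ) = s := rfl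

/-- The indices `1, …, t-1` as elements of `Icc 1 t`. -/
def past (t : ℕ) : Finset (Finset.Icc 1 t) := Finset.univ.map (pastEmb t)

/-- The index `t` in `Icc 1 t`. -/
def present (t : ℕ) (ht : 1 ≤ t) : Finset.Icc 1 t := ⟨t, Finset.mem_Icc.2 ⟨ht, le_rfl⟩⟩

@[simp] lemma present_coe (t : ℕ) (ht : 1 ≤ t) : (present t ht : ℕ) = t := rfl

lemma sum_past {t : ℕ} (F : ℕ → ℝ) :
    ∑ i ∈ past t, F i = ∑ s ∈ Finset.Icc 1 (t - 1), F s := by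
  rw [past, Finset.sum_map, ← Finset.sum_coe_sort (Finset.Icc 1 (t - 1)) F]
  rfl

lemma measurable_obsVec {Y : ℕ → Ω → ℝ} (hY : ∀ t, 1 ≤ t → Measurable (Y t)) (t : ℕ) :
    Measurable (obsVec Y t) :=
  measurable_pi_lambda _ fun i => hY i (Finset.mem_Icc.1 i.2).1

lemma obsSigma_le {Y : ℕ → Ω → ℝ} (hY : ∀ t, 1 ≤ t → Measurable (Y t)) (t : ℕ) :
    obsSigma Y t ≤ (inferInstance : MeasurableSpace Ω) :=
  (measurable_obsVec hY t).comap_le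

lemma IsAdapted.measurable {Y h : ℕ → Ω → ℝ} (hh : IsAdapted Y h)
    (hY : ∀ t, 1 ≤ t → Measurable (Y t)) (t : ℕ) (ht : 1 ≤ t) : Measurable (h t) :=
  (hh t ht).mono (obsSigma_le hY t) le_rfl

/-- The conditional mean of `X_t` given `𝒴_t` under the law weighted by the past errors. -/
noncomputable def condTiltMean (P : Measure Ω) [IsFiniteMeasure P] (X Y : ℕ → Ω → ℝ) (q : ℕ → ℝ)
    (h : ℕ → Ω → ℝ) (t : ℕ) (ht : 1 ≤ t) : Ω → ℝ :=
  fun ω => tiltMean (fun i : Finset.Icc 1 t => q i) (past t) (present t ht) (obsVec h t ω)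
    (condDistrib (obsVec X t) (obsVec Y t) P (obsVec Y t ω))

/-- Bayes' formula puts the conditional law given the augmented observations into the form required
by `mean_sub_cov_likWeight`, which removes the auxiliary observations. -/
lemma Ztilde_ae_eq (P : Measure Ω) [IsProbabilityMeasure P]
    {X Y ε : ℕ → Ω → ℝ} {q : ℕ → ℝ}
    (hX : ∀ t, 1 ≤ t → Measurable (X t)) (hY : ∀ t, 1 ≤ t → Measurable (Y t))
    (hε : ∀ t, 1 ≤ t → Measurable (ε t))
    (hεlaw : ∀ t, 1 ≤ t → HasLaw (ε t) (gaussianReal 0 1) P)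
    (hεindep : iIndepFun (fun (t : Set.Ici (1 : ℕ)) => ε t) P)
    (hεXY : IndepFun (fun ω (t : Set.Ici (1 : ℕ)) => ε t ω)
      (fun ω (t : Set.Ici (1 : ℕ)) => (X t ω, Y t ω)) P)
    (hq : ∀ t, 1 ≤ t → 0 ≤ q t) (hG : IsCondGaussian P X Y)
    {h : ℕ → Ω → ℝ} (hh : IsAdapted Y h) (t : ℕ) (ht : 1 ≤ t) :
    Ztilde P X Y ε q h t =ᵐ[P] condTiltMean P X Y q h t ht := by
  obtain ⟨H, hHm, hH⟩ := hh.exists_eq_comp t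
  have hxm := measurable_obsVec hX t
  have hym := measurable_obsVec hY t
  have hem := measurable_obsVec hε (t - 1)
  set x := obsVec X t with hx
  set y := obsVec Y t with hy
  set e := obsVec ε (t - 1) with he
  let T : ((Finset.Icc 1 t → ℝ) × (Finset.Icc 1 t → ℝ)) × (Finset.Icc 1 (t - 1) → ℝ) →
      (Finset.Icc 1 (t - 1) → ℝ) := fun p s =>
    q s * (p.1.2 (pastEmb t s) - H p.1.1 (pastEmb t s)) + √(q s) * p.2 s
  have hT : Measurable T := by fun_prop
  set W := augVec X Y ε q h t (t - 1) with hW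
  have hWeq : W = fun ω => (y ω, T ((y ω, x ω), e ω)) := by
    funext ω
    refine Prod.ext rfl ?_
    funext s
    have : H (y ω) (pastEmb t s) = h s ω := by rw [hH]; rfl
    simp only [T, this]
    rfl
  have hWm : Measurable W := by rw [hWeq]; fun_prop
  let ρ : Measure (Finset.Icc 1 (t - 1) → ℝ) :=
    Measure.pi fun s : Finset.Icc 1 (t - 1) => gaussianReal 0 (q s).toNNReal
  let L : ((Finset.Icc 1 t → ℝ) × (Finset.Icc 1 (t - 1) → ℝ)) × (Finset.Icc 1 t → ℝ) → ℝ≥0∞ :=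
    fun p => ENNReal.ofReal (Real.exp (∑ s : Finset.Icc 1 (t - 1),
      (p.1.2 s * (p.2 (pastEmb t s) - H p.1.1 (pastEmb t s))
        - q s * (p.2 (pastEmb t s) - H p.1.1 (pastEmb t s)) ^ 2 / 2)))
  have hL : Measurable L := by fun_prop
  have helaw : P.map e = Measure.pi fun _ : Finset.Icc 1 (t - 1) => gaussianReal 0 1 := by
    let g : Finset.Icc 1 (t - 1) → Set.Ici (1 : ℕ) := fun s => ⟨s, (Finset.mem_Icc.1 s.2).1⟩
    have hg : Function.Injective g := fun a b hab =>
      Subtype.ext (congrArg (fun i : Set.Ici (1 : ℕ) => (i : ℕ)) hab)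
    have h1 : iIndepFun (fun (s : Finset.Icc 1 (t - 1)) ω => ε s ω) P := hεindep.precomp hg
    have h2 : P.map e = Measure.pi fun s : Finset.Icc 1 (t - 1) => P.map (ε s) :=
      h1.map_fun_eq_pi_map (fun s => (hε s (Finset.mem_Icc.1 s.2).1).aemeasurable)
    rw [h2]
    congr 1
    funext s
    exact (hεlaw s (Finset.mem_Icc.1 s.2).1).map_eq
  have hind : IndepFun (fun ω => (y ω, x ω)) e P := by
    let φ : (Set.Ici (1 : ℕ) → ℝ) → (Finset.Icc 1 (t - 1) → ℝ) := fun f s =>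
      f ⟨s, (Finset.mem_Icc.1 s.2).1⟩
    let ψ : (Set.Ici (1 : ℕ) → ℝ × ℝ) → (Finset.Icc 1 t → ℝ) × (Finset.Icc 1 t → ℝ) := fun f =>
      (fun s => (f ⟨s, (Finset.mem_Icc.1 s.2).1⟩).2, fun s => (f ⟨s, (Finset.mem_Icc.1 s.2).1⟩).1)
    exact (hεXY.comp (φ := φ) (ψ := ψ) (by fun_prop) (by fun_prop)).symm
  have hbayes := condDistrib_withDensity P hym hxm hem hind hT ρ hL
    (fun p => (ENNReal.ofReal_pos.2 (Real.exp_pos _)).ne') (fun p => by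
      rw [helaw]
      exact map_pi_gaussianReal (q := fun s : Finset.Icc 1 (t - 1) => q s) (fun s => hq s (Finset.mem_Icc.1 s.2).1)
        (fun s => p.2 (pastEmb t s) - H p.1 (pastEmb t s)))
  rw [← hWeq] at hbayes
  have hgauss := ae_of_ae_map hym.aemeasurable (hG t ht)
  let m : (Finset.Icc 1 t → ℝ) × (Finset.Icc 1 (t - 1) → ℝ) → ℝ := fun w =>
    ∫ u, u ∂(condDistrib (X t) W P w)
  have hm : Measurable m := (stronglyMeasurable_id.integral_kernel).measurable
  set W' := augVec X Y ε q h (t - 1) (t - 1) with hW'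
  -- `𝒴̄_{t-1}` is coarser than `𝒴̄_{t,t-1}`: the centring of `ξ_{t-1}` is a function `c` of `W`
  -- through `π`, hence a constant under the conditional law given `W`.
  let π : (Finset.Icc 1 t → ℝ) × (Finset.Icc 1 (t - 1) → ℝ) →
      (Finset.Icc 1 (t - 1) → ℝ) × (Finset.Icc 1 (t - 1) → ℝ) := fun w =>
    (fun s => w.1 (pastEmb t s), w.2)
  have hπ : Measurable π := by fun_prop
  let c : (Finset.Icc 1 t → ℝ) × (Finset.Icc 1 (t - 1) → ℝ) → ℝ := fun w =>
    ∫ u, u ∂(condDistrib (xi X ε q h (t - 1)) W' P (π w))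
  have hc : Measurable c :=
    (stronglyMeasurable_id.integral_kernel).measurable.comp hπ
  let f : ((Finset.Icc 1 t → ℝ) × (Finset.Icc 1 (t - 1) → ℝ)) × (Finset.Icc 1 t → ℝ) → ℝ :=
    fun p => (p.2 (present t ht) - m p.1) * (∑ s : Finset.Icc 1 (t - 1),
      (p.2 (pastEmb t s) - H p.1.1 (pastEmb t s)) * p.1.2 s - c p.1)
  have hf : Measurable f := by fun_prop
  have hmean := ae_of_ae_map hWm.aemeasurable
    (regCondExp_comp P hWm hxm (f := fun p => p.2 (present t ht)) (by fun_prop))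
  have hcov := ae_of_ae_map hWm.aemeasurable (regCondExp_comp P hWm hxm hf)
  have hU : (fun ω' => (X t ω' - regCondExp P W (X t) ω')
      * (xi X ε q h (t - 1) ω' - regCondExp P W' (xi X ε q h (t - 1)) ω'))
      = fun ω => f (W ω, x ω) := by
    funext ω
    have h1 : xi X ε q h (t - 1) ω = ∑ s : Finset.Icc 1 (t - 1),
        (x ω (pastEmb t s) - H (W ω).1 (pastEmb t s)) * (W ω).2 s := by
      rw [xi, ← Finset.sum_coe_sort]
      refine Finset.sum_congr rfl fun s _ => ?_
      have : H (y ω) (pastEmb t s) = h s ω := by rw [hH]; rfl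
      rw [show (W ω).1 = y ω from rfl, this]
      rfl
    rw [h1]
    rfl
  filter_upwards [ae_of_ae_map hWm.aemeasurable hbayes, hgauss, hmean, hcov] with ω hD hg h1 h2
  obtain ⟨D, hD⟩ := hD
  have e1 : Ztilde P X Y ε q h t ω = m (W ω) - ∫ u, u ∂(condDistrib (fun ω => f (W ω, x ω)) W P (W ω)) := by
    rw [← hU]; rfl
  have hmW : m (W ω) = ∫ z, z (present t ht) ∂(condDistrib x W P (W ω)) := h1
  rw [e1, h2, condTiltMean]
  -- The auxiliary values are extended by `0` to the index `t`, which lies outside `past t` and does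
  -- not affect the weight.
  have key := mean_sub_cov_likWeight (q := fun i : Finset.Icc 1 t => q i)
    (fun i => hq i (Finset.mem_Icc.1 i.2).1) (past t) (present t ht) (obsVec h t ω)
    (Function.extend (pastEmb t) (W ω).2 0) (condDistrib x y P (y ω)) (condDistrib x W P (W ω)) D
    (by
      rw [hD]
      congr 1
      funext z
      simp only [L, likWeight, past, Finset.sum_map]
      congr 2
      refine Finset.sum_congr rfl fun s _ => ?_
      rw [(pastEmb t).injective.extend_apply, show (W ω).1 = y ω from rfl, hH]
      rfl) (c (W ω))
  rw [← key, ← hmW]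
  congr 2
  funext z
  simp only [f, past, Finset.sum_map]
  congr 2
  refine Finset.sum_congr rfl fun s _ => ?_
  rw [(pastEmb t).injective.extend_apply, show (W ω).1 = y ω from rfl, hH]

end

/-! ### The recursive filter and the one-step (RS) problem. -/

section

lemma exp_quadCost_eq {Ω : Type*} (X : ℕ → Ω → ℝ) (Q : ℕ → ℝ) (μ : ℝ) (h : ℕ → Ω → ℝ) (t : ℕ) (ω : Ω) :
    Real.exp (μ / 2 * quadCost X Q h (t - 1) ω)
      = quadWeight (fun i : Finset.Icc 1 t => -μ * Q i) (past t) (obsVec h t ω) (obsVec X t ω) := by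
  have h1 := sum_past (t := t) (fun s => -μ * Q s * (X s ω - h s ω) ^ 2 / 2)
  rw [quadWeight]
  congr 1
  simp only [obsVec]
  rw [h1, quadCost, Finset.mul_sum, ← Finset.sum_neg_distrib]
  exact Finset.sum_congr rfl fun s _ => by ring

variable {Ω : Type*} [MeasurableSpace Ω]

/-- Makes the tilted mean an admissible competitor in the one-step problem and the recursive filter
adapted. -/
lemma measurable_condTiltMean (P : Measure Ω) [IsProbabilityMeasure P]
    (X : ℕ → Ω → ℝ) {Y : ℕ → Ω → ℝ} (q : ℕ → ℝ) {h : ℕ → Ω → ℝ} (hh : IsAdapted Y h) (t : ℕ)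
    (ht : 1 ≤ t) : Measurable[obsSigma Y t] (condTiltMean P X Y q h t ht) := by
  obtain ⟨H, hHm, hH⟩ := hh.exists_eq_comp t
  let A : (Finset.Icc 1 t → ℝ) → ℝ := fun y =>
    tiltMean (fun i : Finset.Icc 1 t => q i) (past t) (present t ht) (H y)
      (condDistrib (obsVec X t) (obsVec Y t) P y)
  have hA : Measurable A := by
    refine Measurable.div ?_ ?_
    · exact (StronglyMeasurable.integral_kernel_prod_right'
        (κ := condDistrib (obsVec X t) (obsVec Y t) P)
        (f := fun p : (Finset.Icc 1 t → ℝ) × (Finset.Icc 1 t → ℝ) => p.2 (present t ht)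
          * quadWeight (fun i : Finset.Icc 1 t => q i) (past t) (H p.1) p.2)
        (by fun_prop : Measurable _).stronglyMeasurable).measurable
    · exact (StronglyMeasurable.integral_kernel_prod_right'
        (κ := condDistrib (obsVec X t) (obsVec Y t) P)
        (f := fun p : (Finset.Icc 1 t → ℝ) × (Finset.Icc 1 t → ℝ) =>
          quadWeight (fun i : Finset.Icc 1 t => q i) (past t) (H p.1) p.2)
        (by fun_prop : Measurable _).stronglyMeasurable).measurable
  have : condTiltMean P X Y q h t ht = A ∘ obsVec Y t := by
    funext ω
    simp only [condTiltMean, A, Function.comp_apply, hH]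
  rw [this]
  exact hA.comp (comap_measurable _)

lemma tiltMean_congr {ι : Type*} (q : ι → ℝ) (S : Finset ι) (i : ι) {h h' : ι → ℝ}
    (hh : ∀ j ∈ S, h j = h' j) (γ : Measure (ι → ℝ)) : tiltMean q S i h γ = tiltMean q S i h' γ := by
  have : quadWeight q S h = quadWeight q S h' := by
    funext x
    simp only [quadWeight]
    rw [Finset.sum_congr rfl fun j hj => by rw [hh j hj]]
  rw [tiltMean, tiltMean, this]

lemma coe_lt_of_mem_past {t : ℕ} {i : Finset.Icc 1 t} (hi : i ∈ past t) : (i : ℕ) < t := by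
  obtain ⟨s, -, rfl⟩ := Finset.mem_map.1 hi
  have := Finset.mem_Icc.1 s.2
  simp only [pastEmb_coe]
  omega

/-- The filter defined recursively by `h_t = ` the tilted conditional mean given its own past. -/
noncomputable def optFilter (P : Measure Ω) [IsFiniteMeasure P] (X Y : ℕ → Ω → ℝ) (q : ℕ → ℝ)
    (t : ℕ) : Ω → ℝ :=
  if ht : 1 ≤ t then
    -- The truncation at `s < t` makes the recursion well founded. It changes nothing, because the
    -- weight involves only past indices; see `optFilter_eq`.
    condTiltMean P X Y q (fun s => if _hs : s < t then optFilter P X Y q s else fun _ => 0) t ht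
  else fun _ => 0
termination_by t

lemma optFilter_eq (P : Measure Ω) [IsFiniteMeasure P] (X Y : ℕ → Ω → ℝ) (q : ℕ → ℝ)
    (t : ℕ) (ht : 1 ≤ t) :
    optFilter P X Y q t = condTiltMean P X Y q (optFilter P X Y q) t ht := by
  rw [optFilter, dif_pos ht]
  funext ω
  refine tiltMean_congr _ _ _ (fun i hi => ?_) _
  simp only [obsVec]
  rw [dif_pos (coe_lt_of_mem_past hi)]

lemma isAdapted_optFilter (P : Measure Ω) [IsProbabilityMeasure P] (X Y : ℕ → Ω → ℝ) (q : ℕ → ℝ) :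
    IsAdapted Y (optFilter P X Y q) := by
  intro t
  induction t using Nat.strong_induction_on with
  | _ t ih =>
    intro ht
    rw [optFilter, dif_pos ht]
    refine measurable_condTiltMean P X q (fun s hs => ?_) t ht
    by_cases hst : s < t
    · rw [dif_pos hst]; exact ih s hst hs
    · rw [dif_neg hst]; exact measurable_const

/-- The conditional mass of the weight of the past errors. -/
noncomputable def pastMass (P : Measure Ω) [IsFiniteMeasure P] (X Y : ℕ → Ω → ℝ) (q : ℕ → ℝ)
    (h : ℕ → Ω → ℝ) (t : ℕ) : Ω → ℝ :=
  fun ω => ∫ x, quadWeight (fun i : Finset.Icc 1 t => q i) (past t) (obsVec h t ω) x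
    ∂(condDistrib (obsVec X t) (obsVec Y t) P (obsVec Y t ω))

lemma condExp_exp_quadCost (P : Measure Ω) [IsProbabilityMeasure P] {X Y : ℕ → Ω → ℝ}
    {Q : ℕ → ℝ} {μ : ℝ}
    (hX : ∀ t, 1 ≤ t → Measurable (X t)) (hY : ∀ t, 1 ≤ t → Measurable (Y t))
    (hq : ∀ t, 1 ≤ t → 0 ≤ -μ * Q t) {h : ℕ → Ω → ℝ} (hh : IsAdapted Y h) (t : ℕ) :
    P[fun ω => Real.exp (μ / 2 * quadCost X Q h (t - 1) ω) | obsSigma Y t]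
      =ᵐ[P] pastMass P X Y (fun s => -μ * Q s) h t := by
  obtain ⟨H, hHm, hH⟩ := hh.exists_eq_comp t
  have hxm := measurable_obsVec hX t
  have hym := measurable_obsVec hY t
  have hq' : ∀ i : Finset.Icc 1 t, 0 ≤ -μ * Q i := fun i => hq i (Finset.mem_Icc.1 i.2).1
  let F : (Finset.Icc 1 t → ℝ) × (Finset.Icc 1 t → ℝ) → ℝ := fun p =>
    quadWeight (fun i : Finset.Icc 1 t => -μ * Q i) (past t) (H p.1) p.2
  have hF : Measurable F := by fun_prop
  have e : (fun ω => Real.exp (μ / 2 * quadCost X Q h (t - 1) ω))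
      = fun ω => F (obsVec Y t ω, obsVec X t ω) := by
    funext ω
    simp only [F, exp_quadCost_eq, hH]
  rw [e]
  refine (condExp_prod_ae_eq_integral_condDistrib hym hxm.aemeasurable hF.stronglyMeasurable
    ?_).trans (ae_of_all _ fun ω => ?_)
  · refine Integrable.of_bound (by fun_prop : Measurable _).aestronglyMeasurable 1
      (ae_of_all _ fun ω => ?_)
    rw [Real.norm_of_nonneg (quadWeight_pos ..).le]
    exact quadWeight_le_one hq' _ _ _
  · simp only [F, pastMass, hH]

/-- The explicit form of the one-step criterion for conditionally Gaussian processes. -/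
lemma exists_rsRisk_eq (P : Measure Ω) [IsProbabilityMeasure P] {X Y : ℕ → Ω → ℝ}
    {Q : ℕ → ℝ} {μ : ℝ}
    (hX : ∀ t, 1 ≤ t → Measurable (X t)) (hY : ∀ t, 1 ≤ t → Measurable (Y t))
    (hq : ∀ t, 1 ≤ t → 0 ≤ -μ * Q t) (hG : IsCondGaussian P X Y) (t : ℕ) (ht : 1 ≤ t) :
    ∃ V : (Finset.Icc 1 t → Finset.Icc 1 t → ℝ) → ℝ, ∀ h, IsAdapted Y h → ∀ g : Ω → ℝ,
      Measurable[obsSigma Y t] g → ∀ᵐ ω ∂P,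
        0 ≤ V (covFun (condDistrib (obsVec X t) (obsVec Y t) P (obsVec Y t ω))) ∧
        0 < pastMass P X Y (fun s => -μ * Q s) h t ω ∧
        rsRisk P X Y Q μ h t g ω = μ * (pastMass P X Y (fun s => -μ * Q s) h t ω
          * ((√(1 + -μ * Q t * V (covFun
              (condDistrib (obsVec X t) (obsVec Y t) P (obsVec Y t ω)))))⁻¹
            * Real.exp (-(-μ * Q t * (condTiltMean P X Y (fun s => -μ * Q s) h t ht ω - g ω) ^ 2
              / (2 * (1 + -μ * Q t * V (covFun
                (condDistrib (obsVec X t) (obsVec Y t) P (obsVec Y t ω))))))))) := by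
  have hq' : ∀ i : Finset.Icc 1 t, 0 ≤ -μ * Q i := fun i => hq i (Finset.mem_Icc.1 i.2).1
  obtain ⟨V, hV⟩ := exists_integral_quadWeight_mul hq' (past t) (present t ht)
  refine ⟨V, fun h hh g hg => ?_⟩
  obtain ⟨H, hHm, hH⟩ := hh.exists_eq_comp t
  obtain ⟨G, hGm, rfl⟩ := hg.exists_eq_measurable_comp
  have hxm := measurable_obsVec hX t
  have hym := measurable_obsVec hY t
  let F : (Finset.Icc 1 t → ℝ) × (Finset.Icc 1 t → ℝ) → ℝ := fun p =>
    μ * (quadWeight (fun i : Finset.Icc 1 t => -μ * Q i) (past t) (H p.1) p.2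
      * Real.exp (-(-μ * Q t * (p.2 (present t ht) - G p.1) ^ 2 / 2)))
  have hF : Measurable F := by fun_prop
  have e : (fun ω => μ * Real.exp (μ / 2 * ((X t ω - (G ∘ obsVec Y t) ω) ^ 2 * Q t)
      + μ / 2 * quadCost X Q h (t - 1) ω)) = fun ω => F (obsVec Y t ω, obsVec X t ω) := by
    funext ω
    simp only [F]
    rw [Real.exp_add, exp_quadCost_eq, hH, mul_comm (Real.exp _)]
    congr 3
    simp only [Function.comp_apply, obsVec, present_coe]
    ring
  have h1 : rsRisk P X Y Q μ h t (G ∘ obsVec Y t) =ᵐ[P]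
      fun ω => ∫ x, F (obsVec Y t ω, x) ∂(condDistrib (obsVec X t) (obsVec Y t) P (obsVec Y t ω)) := by
    rw [rsRisk, e]
    refine condExp_prod_ae_eq_integral_condDistrib hym hxm.aemeasurable hF.stronglyMeasurable ?_
    refine Integrable.of_bound (by fun_prop : Measurable _).aestronglyMeasurable |μ|
      (ae_of_all _ fun ω => ?_)
    rw [norm_mul, Real.norm_eq_abs]
    refine mul_le_of_le_one_right (abs_nonneg _) ?_
    rw [Real.norm_of_nonneg (mul_pos (quadWeight_pos ..) (Real.exp_pos _)).le]
    refine mul_le_one₀ (quadWeight_le_one hq' _ _ _) (Real.exp_pos _).le (Real.exp_le_one_iff.2 ?_)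
    have := hq t ht
    rw [neg_nonpos]
    positivity
  filter_upwards [h1, ae_of_ae_map hym.aemeasurable (hG t ht)] with ω hω hgω
  obtain ⟨hV0, hV1⟩ := hV (condDistrib (obsVec X t) (obsVec Y t) P (obsVec Y t ω))
    (H (obsVec Y t ω)) (G (obsVec Y t ω))
  refine ⟨hV0, integral_quadWeight_pos hq' _ _ _, ?_⟩
  rw [hω]
  simp only [F]
  rw [integral_const_mul]
  simp only [present_coe] at hV1
  rw [hV1, hH]
  rfl

/-- The one-step criterion is `μ < 0` times a positive factor times a Gaussian bump in `g` centred
at the tilted mean. -/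
lemma isRSSolution_iff (P : Measure Ω) [IsProbabilityMeasure P] {X Y : ℕ → Ω → ℝ}
    {Q : ℕ → ℝ} {μ : ℝ}
    (hX : ∀ t, 1 ≤ t → Measurable (X t)) (hY : ∀ t, 1 ≤ t → Measurable (Y t))
    (hQ : ∀ t, 1 ≤ t → 0 ≤ Q t) (hμ : μ < 0) (hG : IsCondGaussian P X Y)
    {h : ℕ → Ω → ℝ} (hh : IsAdapted Y h) (T : ℕ) :
    IsRSSolution P X Y Q μ T h ↔ ∀ t ∈ Finset.Icc 1 T, ∀ ht : 1 ≤ t, 0 < Q t →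
      h t =ᵐ[P] condTiltMean P X Y (fun s => -μ * Q s) h t ht := by
  have hq : ∀ t, 1 ≤ t → 0 ≤ -μ * Q t := fun t ht => mul_nonneg (by linarith) (hQ t ht)
  rw [IsRSSolution, and_iff_right hh]
  refine forall₂_congr fun t htT => ?_
  have ht := (Finset.mem_Icc.1 htT).1
  obtain ⟨V, hV⟩ := exists_rsRisk_eq P hX hY hq hG t ht
  constructor
  · intro H _ hQt
    have hqt : 0 < -μ * Q t := mul_pos (by linarith) hQt
    have hm := measurable_condTiltMean P X (fun s => -μ * Q s) hh t ht
    -- Comparison with the tilted mean itself, where the bump has its maximal value.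
    filter_upwards [H _ hm, hV h hh _ (hh t ht), hV h hh _ hm] with ω h1 h2 h3
    obtain ⟨v0, m0, h2⟩ := h2
    obtain ⟨-, -, h3⟩ := h3
    rw [h2, h3] at h1
    set v := V (covFun (condDistrib (obsVec X t) (obsVec Y t) P (obsVec Y t ω)))
    set a := condTiltMean P X Y (fun s => -μ * Q s) h t ht ω
    have hd : 0 < 1 + -μ * Q t * v := by positivity
    have h4 := (mul_le_mul_left_of_neg hμ).1 h1
    have h5 := le_of_mul_le_mul_left (le_of_mul_le_mul_left h4 m0) (by positivity)
    rw [Real.exp_le_exp, neg_le_neg_iff, sub_self, zero_pow two_ne_zero, mul_zero, zero_div] at h5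
    rw [div_le_iff₀ (by positivity), zero_mul] at h5
    have h6 : (a - h t ω) ^ 2 ≤ 0 := by
      by_contra hc
      push Not at hc
      nlinarith [mul_pos hqt hc]
    have h7 : a - h t ω = 0 := by
      rwa [sq_nonpos_iff] at h6
    linarith
  · intro H g hg
    have key : ∀ᵐ ω ∂P, -μ * Q t * (condTiltMean P X Y (fun s => -μ * Q s) h t ht ω - h t ω) ^ 2
        = 0 := by
      -- When `Q t = 0` the criterion does not depend on `g`, so every choice is optimal.
      rcases (hQ t ht).eq_or_lt with h0 | h0
      · exact ae_of_all _ fun ω => by rw [← h0]; ring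
      · filter_upwards [H ht h0] with ω hω
        rw [hω]; ring
    filter_upwards [hV h hh _ (hh t ht), hV h hh g hg, key] with ω h2 h3 hk
    obtain ⟨v0, m0, h2⟩ := h2
    obtain ⟨-, -, h3⟩ := h3
    rw [h2, h3, hk, mul_le_mul_left_of_neg hμ]
    have hqt := hq t ht
    refine mul_le_mul_of_nonneg_left (mul_le_mul_of_nonneg_left (Real.exp_le_exp.2 ?_)
      (by positivity)) m0.le
    rw [neg_le_neg_iff, zero_div]
    positivity

end

/-! ### The LEG problem by dynamic programming. -/

section

lemma quadCost_eq_add {Ω : Type*} (X : ℕ → Ω → ℝ) (Q : ℕ → ℝ) (h : ℕ → Ω → ℝ) (t : ℕ)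
    (ht : 1 ≤ t) (ω : Ω) :
    quadCost X Q h t ω = (X t ω - h t ω) ^ 2 * Q t + quadCost X Q h (t - 1) ω := by
  obtain ⟨n, rfl⟩ : ∃ n, t = n + 1 := ⟨t - 1, by omega⟩
  rw [quadCost, quadCost, Finset.sum_Icc_succ_top (by omega), add_comm, Nat.add_sub_cancel]

variable {Ω : Type*} [MeasurableSpace Ω]

/-- The expected exponential weight `E exp{(μ/2) ∑_{s=1}^{t} (X_s - h_s)² Q_s}`. -/
noncomputable def expWeight (P : Measure Ω) (X : ℕ → Ω → ℝ) (Q : ℕ → ℝ) (μ : ℝ) (t : ℕ)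
    (h : ℕ → Ω → ℝ) : ℝ :=
  ∫ ω, Real.exp (μ / 2 * quadCost X Q h t ω) ∂P

/-- One step of dynamic programming for the exponential criterion. -/
lemma exists_expWeight_le (P : Measure Ω) [IsProbabilityMeasure P] {X Y : ℕ → Ω → ℝ}
    {Q : ℕ → ℝ} {μ : ℝ}
    (hX : ∀ t, 1 ≤ t → Measurable (X t)) (hY : ∀ t, 1 ≤ t → Measurable (Y t))
    (hQ : ∀ t, 1 ≤ t → 0 ≤ Q t) (hμ : μ < 0) (hG : IsCondGaussian P X Y)
    (hC : HasNonrandomCondCov P X Y) (t : ℕ) (ht : 1 ≤ t) :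
    ∃ c : ℝ, 0 < c ∧ ∀ h, IsAdapted Y h →
      expWeight P X Q μ t h ≤ c * expWeight P X Q μ (t - 1) h ∧
      (expWeight P X Q μ t h = c * expWeight P X Q μ (t - 1) h ↔
        (0 < Q t → h t =ᵐ[P] condTiltMean P X Y (fun s => -μ * Q s) h t ht)) := by
  have hq : ∀ t, 1 ≤ t → 0 ≤ -μ * Q t := fun t ht => mul_nonneg (by linarith) (hQ t ht)
  have hqt := hq t ht
  obtain ⟨V, hV⟩ := exists_rsRisk_eq P hX hY hq hG t ht
  obtain ⟨K, hK⟩ := hC t ht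
  have hKω : ∀ᵐ ω ∂P, covFun (condDistrib (obsVec X t) (obsVec Y t) P (obsVec Y t ω))
      = fun i j => K i j := by
    filter_upwards [ae_of_ae_map (measurable_obsVec hY t).aemeasurable hK] with ω hω
    funext i j
    exact hω i j
  set v := V (fun i j => K i j) with hv
  -- Nonnegativity of `V` is known only at covariances of the Gaussian conditional laws. Almost
  -- surely these equal `K`, so a single `ω`, with the zero filter as a test sequence, is enough.
  have hv0 : 0 ≤ v := by
    have hz : IsAdapted Y (fun _ _ => 0) := fun t _ => measurable_const
    obtain ⟨ω, h1, h2⟩ := ((hV _ hz (fun _ => 0) measurable_const).and hKω).exists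
    rw [h2] at h1
    exact h1.1
  have hd : 0 < 1 + -μ * Q t * v := by positivity
  refine ⟨(√(1 + -μ * Q t * v))⁻¹, by positivity, fun h hh => ?_⟩
  set c := (√(1 + -μ * Q t * v))⁻¹ with hc
  have hc0 : 0 < c := by positivity
  set C := pastMass P X Y (fun s => -μ * Q s) h t with hCdef
  set a := condTiltMean P X Y (fun s => -μ * Q s) h t ht with ha
  let E : Ω → ℝ := fun ω => Real.exp (-(-μ * Q t * (a ω - h t ω) ^ 2 / (2 * (1 + -μ * Q t * v))))
  have hform : ∀ᵐ ω ∂P, 0 < C ω ∧ rsRisk P X Y Q μ h t (h t) ω = μ * (C ω * (c * E ω)) := by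
    filter_upwards [hV h hh _ (hh t ht), hKω] with ω h1 h2
    rw [h2] at h1
    exact h1.2
  have hle := obsSigma_le hY t
  have hC1 := condExp_exp_quadCost P hX hY hq hh t
  have hCint : Integrable C P := integrable_condExp.congr hC1
  have hJ1 : expWeight P X Q μ (t - 1) h = ∫ ω, C ω ∂P := by
    rw [expWeight, ← integral_condExp hle]
    exact integral_congr_ae hC1
  have hR : rsRisk P X Y Q μ h t (h t) =ᵐ[P] fun ω => μ * (C ω * (c * E ω)) :=
    hform.mono fun ω hω => hω.2
  have hRint : Integrable (fun ω => C ω * (c * E ω)) P := by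
    have h1 : Integrable (fun ω => μ * (C ω * (c * E ω))) P := integrable_condExp.congr hR
    have h2 := h1.const_mul μ⁻¹
    simpa [← mul_assoc, inv_mul_cancel₀ hμ.ne] using h2
  -- Since `h_t` is `𝒴_t`-measurable, the one-step criterion at `g = h_t` is the conditional
  -- expectation of the full weight up to `t`.
  have hJ : expWeight P X Q μ t h = ∫ ω, C ω * (c * E ω) ∂P := by
    have h1 : ∫ ω, rsRisk P X Y Q μ h t (h t) ω ∂P = μ * expWeight P X Q μ t h := by
      rw [rsRisk, integral_condExp hle, integral_const_mul, expWeight]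
      congr 1
      refine integral_congr_ae (ae_of_all _ fun ω => ?_)
      simp only
      rw [quadCost_eq_add X Q h t ht, mul_add]
    rw [integral_congr_ae hR, integral_const_mul] at h1
    exact (mul_left_cancel₀ hμ.ne h1).symm
  have hE1 : ∀ ω, E ω ≤ 1 := fun ω => Real.exp_le_one_iff.2 (neg_nonpos.2 (by positivity))
  -- The deficit is `c C (1 - E)` with `c C > 0` and `E ≤ 1`; its integral vanishes iff `E = 1` a.s.
  have hnn : 0 ≤ᵐ[P] fun ω => c * C ω - C ω * (c * E ω) := by
    filter_upwards [hform] with ω hω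
    have : c * C ω - C ω * (c * E ω) = c * C ω * (1 - E ω) := by ring
    rw [this]
    exact mul_nonneg (mul_pos hc0 hω.1).le (by linarith [hE1 ω])
  have hdiff : ∫ ω, (c * C ω - C ω * (c * E ω)) ∂P
      = c * expWeight P X Q μ (t - 1) h - expWeight P X Q μ t h := by
    rw [integral_sub (hCint.const_mul c) hRint, integral_const_mul, hJ1, hJ]
  refine ⟨by linarith [integral_nonneg_of_ae hnn], ?_⟩
  have h0 : expWeight P X Q μ t h = c * expWeight P X Q μ (t - 1) h ↔
      ∀ᵐ ω ∂P, c * C ω - C ω * (c * E ω) = 0 := by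
    have := integral_eq_zero_iff_of_nonneg_ae hnn ((hCint.const_mul c).sub hRint)
    rw [hdiff, sub_eq_zero, eq_comm] at this
    exact this
  rw [h0]
  have hiff : (∀ᵐ ω ∂P, c * C ω - C ω * (c * E ω) = 0) ↔
      ∀ᵐ ω ∂P, -μ * Q t * (a ω - h t ω) ^ 2 = 0 := by
    have h1 : ∀ᵐ ω ∂P, (c * C ω - C ω * (c * E ω) = 0 ↔ -μ * Q t * (a ω - h t ω) ^ 2 = 0) := by
      filter_upwards [hform] with ω hω
      have e1 : c * C ω - C ω * (c * E ω) = c * C ω * (1 - E ω) := by ring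
      rw [e1, mul_eq_zero_iff_left (mul_pos hc0 hω.1).ne', sub_eq_zero, eq_comm, Real.exp_eq_one_iff,
        neg_eq_zero, div_eq_zero_iff, or_iff_left (by positivity)]
    exact Filter.eventually_congr h1
  rw [hiff]
  constructor
  · intro H hQt
    have hqt' : 0 < -μ * Q t := mul_pos (by linarith) hQt
    filter_upwards [H] with ω hω
    rw [mul_eq_zero_iff_left hqt'.ne', sq_eq_zero_iff, sub_eq_zero] at hω
    exact hω.symm
  · intro H
    rcases (hQ t ht).eq_or_lt with h0 | h0
    · exact ae_of_all _ fun ω => by rw [← h0]; ring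
    · filter_upwards [H h0] with ω hω
      rw [hω]; ring

/-- `M` is the product of the one-step constants. Because they are deterministic and independent of
`h`, improving a past error never conflicts with later ones. -/
lemma exists_expWeight_max (P : Measure Ω) [IsProbabilityMeasure P] {X Y : ℕ → Ω → ℝ}
    {Q : ℕ → ℝ} {μ : ℝ}
    (hX : ∀ t, 1 ≤ t → Measurable (X t)) (hY : ∀ t, 1 ≤ t → Measurable (Y t))
    (hQ : ∀ t, 1 ≤ t → 0 ≤ Q t) (hμ : μ < 0) (hG : IsCondGaussian P X Y)
    (hC : HasNonrandomCondCov P X Y) (T : ℕ) :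
    ∃ M : ℝ, 0 < M ∧ ∀ h, IsAdapted Y h →
      expWeight P X Q μ T h ≤ M ∧
      (expWeight P X Q μ T h = M ↔ ∀ t ∈ Finset.Icc 1 T, ∀ ht : 1 ≤ t, 0 < Q t →
        h t =ᵐ[P] condTiltMean P X Y (fun s => -μ * Q s) h t ht) := by
  induction T with
  | zero =>
    refine ⟨1, one_pos, fun h _ => ?_⟩
    simp [expWeight, quadCost]
  | succ T ih =>
    obtain ⟨M, hM0, hM⟩ := ih
    obtain ⟨c, hc0, hc⟩ := exists_expWeight_le P hX hY hQ hμ hG hC (T + 1) (by omega)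
    refine ⟨c * M, mul_pos hc0 hM0, fun h hh => ?_⟩
    obtain ⟨h1, h2⟩ := hc h hh
    obtain ⟨h3, h4⟩ := hM h hh
    rw [Nat.add_sub_cancel] at h1 h2
    have h5 : c * expWeight P X Q μ T h ≤ c * M := mul_le_mul_of_nonneg_left h3 hc0.le
    refine ⟨h1.trans h5, ?_⟩
    -- Equality between the ends of `E_{T+1} ≤ c E_T ≤ c M` forces equality in both places; `c > 0`
    -- is then cancelled.
    have h6 : expWeight P X Q μ (T + 1) h = c * M ↔
        expWeight P X Q μ (T + 1) h = c * expWeight P X Q μ T h ∧ expWeight P X Q μ T h = M := by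
      constructor
      · intro e
        have e1 : c * expWeight P X Q μ T h = c * M := le_antisymm h5 (e ▸ h1)
        exact ⟨e.trans e1.symm, mul_left_cancel₀ hc0.ne' e1⟩
      · rintro ⟨e1, e2⟩
        rw [e1, e2]
    rw [h6, h2, h4]
    constructor
    · rintro ⟨a, b⟩ t htT ht
      rcases Nat.lt_or_ge T t with hlt | hge
      · obtain rfl : t = T + 1 := le_antisymm (Finset.mem_Icc.1 htT).2 hlt
        exact a
      · exact b t (Finset.mem_Icc.2 ⟨ht, hge⟩) ht
    · intro H
      exact ⟨H (T + 1) (by simp) (by omega),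
        fun t htT => H t (Finset.mem_Icc.2 ⟨(Finset.mem_Icc.1 htT).1,
          (Finset.mem_Icc.1 htT).2.trans (Nat.le_succ T)⟩)⟩

lemma isLEGSolution_iff (P : Measure Ω) [IsProbabilityMeasure P] {X Y : ℕ → Ω → ℝ}
    {Q : ℕ → ℝ} {μ : ℝ}
    (hX : ∀ t, 1 ≤ t → Measurable (X t)) (hY : ∀ t, 1 ≤ t → Measurable (Y t))
    (hQ : ∀ t, 1 ≤ t → 0 ≤ Q t) (hμ : μ < 0) (hG : IsCondGaussian P X Y)
    (hC : HasNonrandomCondCov P X Y) {h : ℕ → Ω → ℝ} (hh : IsAdapted Y h) (T : ℕ) :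
    IsLEGSolution P X Y Q μ T h ↔ ∀ t ∈ Finset.Icc 1 T, ∀ ht : 1 ≤ t, 0 < Q t →
      h t =ᵐ[P] condTiltMean P X Y (fun s => -μ * Q s) h t ht := by
  obtain ⟨M, hM0, hM⟩ := exists_expWeight_max P hX hY hQ hμ hG hC T
  have hrisk : ∀ h, legRisk P X Q μ T h = μ * expWeight P X Q μ T h := fun h => by
    rw [legRisk, integral_const_mul, expWeight]
  rw [← (hM h hh).2, IsLEGSolution, and_iff_right hh]
  simp_rw [hrisk, mul_le_mul_left_of_neg hμ]
  constructor
  · intro H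
    -- The recursive filter attains the bound `M`, so every minimizer of the criterion must reach it
    -- too.
    have ho := isAdapted_optFilter P X Y (fun s => -μ * Q s)
    have hmax := (hM _ ho).2.2 fun t _ ht _ => by rw [optFilter_eq _ _ _ _ t ht]
    exact le_antisymm (hM h hh).1 (hmax ▸ H _ ho)
  · intro e h' hh'
    rw [e]
    exact (hM h' hh').1

end

/-! ### Jointly Gaussian processes are conditionally Gaussian with deterministic covariances. -/

section

variable {Ω : Type*} [MeasurableSpace Ω]

/-- Linear regression: residuals uncorrelated with the regressors. -/
lemma exists_covariance_sub_sum_eq_zero (P : Measure Ω) [IsProbabilityMeasure P] {κ : Type*}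
    [Fintype κ] {X : Ω → ℝ} {Y : κ → Ω → ℝ} (hX : MemLp X 2 P) (hY : ∀ j, MemLp (Y j) 2 P) :
    ∃ a : κ → ℝ, ∀ k, cov[fun ω => X ω - ∑ j, a j * Y j ω, Y k; P] = 0 := by
  have hc : ∀ {f : Ω → ℝ}, MemLp f 2 P → MemLp (fun ω => f ω - ∫ ω', f ω' ∂P) 2 P :=
    fun hf => hf.sub (memLp_const _)
  have hinner : ∀ {f g : Ω → ℝ} (hf : MemLp f 2 P) (hg : MemLp g 2 P),
      inner ℝ ((hc hg).toLp _) ((hc hf).toLp _) = cov[f, g; P] := by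
    intro f g hf hg
    rw [L2.inner_def, covariance]
    refine integral_congr_ae ?_
    filter_upwards [(hc hg).coeFn_toLp, (hc hf).coeFn_toLp] with ω h1 h2
    rw [h1, h2]
    simp
  let U : κ → Lp ℝ 2 P := fun j => (hc (hY j)).toLp _
  let K : Submodule ℝ (Lp ℝ 2 P) := Submodule.span ℝ (Set.range U)
  have : FiniteDimensional ℝ K := FiniteDimensional.span_of_finite ℝ (Set.finite_range U)
  let V : Lp ℝ 2 P := (hc hX).toLp _
  obtain ⟨a, ha⟩ := (Submodule.mem_span_range_iff_exists_fun ℝ).1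
    (K.starProjection_apply_mem V : K.starProjection V ∈ K)
  refine ⟨a, fun k => ?_⟩
  have hm : ∀ j, MemLp (fun ω => a j * Y j ω) 2 P := fun j => (hY j).const_mul _
  have horth : inner ℝ (U k) (V - K.starProjection V) = 0 :=
    (K.sub_starProjection_mem_orthogonal V) _ (Submodule.subset_span ⟨k, rfl⟩)
  rw [covariance_fun_sub_left hX (memLp_finsetSum _ fun j _ => hm j) (hY k),
    covariance_fun_sum_left hm (hY k)]
  simp_rw [covariance_const_mul_left, ← hinner (hY _) (hY k), ← hinner hX (hY k)]
  rw [← ha, inner_sub_right, inner_sum] at horth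
  simp_rw [inner_smul_right] at horth
  exact horth

/-- The conditional distribution of `X` given `Y` for jointly Gaussian vectors. -/
lemma exists_condDistrib_of_hasGaussianLaw (P : Measure Ω) [IsProbabilityMeasure P]
    {ι κ : Type*} [Fintype ι] [Fintype κ] {X : Ω → ι → ℝ} {Y : Ω → κ → ℝ} (hX : Measurable X)
    (hY : Measurable Y) (hXY : HasGaussianLaw (fun ω => (X ω, Y ω)) P) :
    ∃ (γ : Measure (ι → ℝ)) (a : (κ → ℝ) → (ι → ℝ)), IsGaussian γ ∧
      ∀ᵐ y ∂(P.map Y), condDistrib X Y P y = γ.map (fun r => r + a y) := by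
  have hX2 : ∀ i, MemLp (fun ω => X ω i) 2 P := fun i =>
    (hXY.fst.map_fun (ContinuousLinearMap.proj (R := ℝ) (φ := fun _ : ι => ℝ) i)).memLp_two
  have hY2 : ∀ j, MemLp (fun ω => Y ω j) 2 P := fun j =>
    (hXY.snd.map_fun (ContinuousLinearMap.proj (R := ℝ) (φ := fun _ : κ => ℝ) j)).memLp_two
  choose A hA using fun i => exists_covariance_sub_sum_eq_zero P (hX2 i) hY2
  let a : (κ → ℝ) →L[ℝ] (ι → ℝ) := ContinuousLinearMap.pi fun i => linForm (A i)
  have ham : Measurable a := a.continuous.measurable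
  let R : Ω → ι → ℝ := fun ω => X ω - a (Y ω)
  have hR : Measurable R := by fun_prop
  have hRY : HasGaussianLaw (fun ω => (R ω, Y ω)) P := hXY.map_fun
    ((ContinuousLinearMap.fst ℝ (ι → ℝ) (κ → ℝ)
      - a.comp (ContinuousLinearMap.snd ℝ (ι → ℝ) (κ → ℝ))).prod
      (ContinuousLinearMap.snd ℝ (ι → ℝ) (κ → ℝ)))
  have hind : IndepFun R Y P := by
    refine hRY.indepFun_of_covariance_eval (X := fun i ω => R ω i) (Y := fun j ω => Y ω j)
      fun i k => ?_
    have := hA i k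
    simpa [R, a] using this
  have hγ : IsGaussian (P.map R) := hRY.fst.isGaussian_map
  refine ⟨P.map R, a, hγ, ?_⟩
  have hs : Measurable fun p : (κ → ℝ) × (ι → ℝ) => p.2 + a p.1 := by fun_prop
  -- With `R` independent of `Y` and `X = R + a Y`, conditioning on `Y = y` merely translates the
  -- law of `R` by `a y`.
  let η : Kernel (κ → ℝ) (ι → ℝ) :=
    (Kernel.id ×ₖ Kernel.const _ (P.map R)).map (fun p => p.2 + a p.1)
  have hη : ∀ y, η y = (P.map R).map (fun r => r + a y) := fun y => by
    simp only [η]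
    rw [Kernel.map_apply _ hs, Kernel.prod_apply, Kernel.id_apply, Kernel.const_apply,
      Measure.dirac_prod, Measure.map_map hs (by fun_prop)]
    rfl
  have key : condDistrib X Y P =ᵐ[P.map Y] η := by
    refine condDistrib_ae_eq_of_measure_eq_compProd Y hX.aemeasurable ?_
    refine Measure.ext_of_lintegral _ fun F hF => ?_
    rw [lintegral_map hF (by fun_prop), Measure.lintegral_compProd hF]
    have e1 : ∀ y, ∫⁻ x, F (y, x) ∂(η y) = ∫⁻ r, F (y, r + a y) ∂(P.map R) := fun y => by
      rw [hη, lintegral_map (by fun_prop) (by fun_prop)]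
    simp_rw [e1]
    rw [← lintegral_prod (fun p : (κ → ℝ) × (ι → ℝ) => F (p.1, p.2 + a p.1)) (by fun_prop),
      ← (indepFun_iff_map_prod_eq_prod_map_map hY.aemeasurable hR.aemeasurable).1 hind.symm,
      lintegral_map (by fun_prop) (by fun_prop)]
    simp [R]
  filter_upwards [key] with y hy
  rw [hy, hη]

lemma IsJointlyGaussian.hasGaussianLaw {P : Measure Ω} {X Y : ℕ → Ω → ℝ}
    (h : IsJointlyGaussian P X Y) (t : ℕ) :
    HasGaussianLaw (fun ω => (obsVec X t ω, obsVec Y t ω)) P := by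
  classical
  let g : Finset.Icc 1 t → Set.Ici (1 : ℕ) := fun s => ⟨s, (Finset.mem_Icc.1 s.2).1⟩
  let I : Finset (Set.Ici (1 : ℕ)) := Finset.univ.image g
  let e : Finset.Icc 1 t → I := fun s => ⟨g s, Finset.mem_image_of_mem g (Finset.mem_univ s)⟩
  let L : (I → ℝ × ℝ) →L[ℝ] (Finset.Icc 1 t → ℝ) × (Finset.Icc 1 t → ℝ) :=
    (ContinuousLinearMap.pi fun s => (ContinuousLinearMap.fst ℝ ℝ ℝ).comp
      (ContinuousLinearMap.proj (R := ℝ) (φ := fun _ : I => ℝ × ℝ) (e s))).prod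
    (ContinuousLinearMap.pi fun s => (ContinuousLinearMap.snd ℝ ℝ ℝ).comp
      (ContinuousLinearMap.proj (R := ℝ) (φ := fun _ : I => ℝ × ℝ) (e s)))
  exact (IsGaussianProcess.hasGaussianLaw h I).map_fun L

/-- The conditional laws are translates of one fixed Gaussian law, and translations leave
covariances unchanged. -/
lemma IsJointlyGaussian.isCondGaussian (P : Measure Ω) [IsProbabilityMeasure P]
    {X Y : ℕ → Ω → ℝ} (hX : ∀ t, 1 ≤ t → Measurable (X t)) (hY : ∀ t, 1 ≤ t → Measurable (Y t))
    (h : IsJointlyGaussian P X Y) : IsCondGaussian P X Y ∧ HasNonrandomCondCov P X Y := by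
  have H := fun t => exists_condDistrib_of_hasGaussianLaw P (measurable_obsVec hX t)
    (measurable_obsVec hY t) (h.hasGaussianLaw t)
  refine ⟨fun t _ => ?_, fun t _ => ?_⟩
  · obtain ⟨γ, a, hγ, hy⟩ := H t
    filter_upwards [hy] with y hy
    rw [hy]
    infer_instance
  · obtain ⟨γ, a, hγ, hy⟩ := H t
    refine ⟨fun i j => covFun γ i j, ?_⟩
    filter_upwards [hy] with y hy i j
    rw [hy, covariance_map_fun (measurable_pi_apply i).aestronglyMeasurable
      (measurable_pi_apply j).aestronglyMeasurable (by fun_prop)]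
    simp only [Pi.add_apply]
    rw [covariance_add_const_left (integrable_eval γ i),
      covariance_add_const_right (integrable_eval γ j)]
    rfl

end

end LEGFiltering

/-! ### Assembly of both parts through the tilted conditional mean. -/

open LEGFiltering in
theorem mainTheorem6 {Ω : Type*} [MeasurableSpace Ω] (P : Measure Ω) [IsProbabilityMeasure P]
    (X Y ε : ℕ → Ω → ℝ) (Q : ℕ → ℝ) (μ : ℝ)
    (hX : ∀ t, 1 ≤ t → Measurable (X t)) (hY : ∀ t, 1 ≤ t → Measurable (Y t))
    (hε : ∀ t, 1 ≤ t → Measurable (ε t))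
    (hεlaw : ∀ t, 1 ≤ t → HasLaw (ε t) (gaussianReal 0 1) P)
    (hεindep : iIndepFun (fun (t : Set.Ici (1 : ℕ)) => ε t) P)
    (hεXY : IndepFun (fun ω (t : Set.Ici (1 : ℕ)) => ε t ω)
      (fun ω (t : Set.Ici (1 : ℕ)) => (X t ω, Y t ω)) P)
    (hQ : ∀ t, 1 ≤ t → 0 ≤ Q t) (hμ : μ < 0) :
    ((LEGFiltering.IsJointlyGaussian P X Y ∨ LEGFiltering.IsCondGaussian P X Y) →
      (∃ h, LEGFiltering.IsAdapted Y h ∧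
        ∀ t, 1 ≤ t → h t =ᵐ[P] LEGFiltering.Ztilde P X Y ε (fun s => -μ * Q s) h t) ∧
      ∀ h, LEGFiltering.IsAdapted Y h → ∀ T : ℕ,
        (LEGFiltering.IsRSSolution P X Y Q μ T h ↔
          ∀ t ∈ Finset.Icc 1 T, 0 < Q t →
            h t =ᵐ[P] LEGFiltering.Ztilde P X Y ε (fun s => -μ * Q s) h t)) ∧
    ((LEGFiltering.IsJointlyGaussian P X Y ∨
        (LEGFiltering.IsCondGaussian P X Y ∧ LEGFiltering.HasNonrandomCondCov P X Y)) →
      ∀ h, LEGFiltering.IsAdapted Y h → ∀ T : ℕ,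
        (LEGFiltering.IsLEGSolution P X Y Q μ T h ↔
          ∀ t ∈ Finset.Icc 1 T, 0 < Q t →
            h t =ᵐ[P] LEGFiltering.Ztilde P X Y ε (fun s => -μ * Q s) h t)) := by
  have hq : ∀ t, 1 ≤ t → 0 ≤ -μ * Q t := fun t ht => mul_nonneg (by linarith) (hQ t ht)
  have hZ : IsCondGaussian P X Y → ∀ h, IsAdapted Y h → ∀ t (ht : 1 ≤ t),
      Ztilde P X Y ε (fun s => -μ * Q s) h t
        =ᵐ[P] condTiltMean P X Y (fun s => -μ * Q s) h t ht :=
    fun hG h hh t ht => Ztilde_ae_eq P hX hY hε hεlaw hεindep hεXY hq hG hh t ht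
  have hiff : IsCondGaussian P X Y → ∀ h, IsAdapted Y h → ∀ T : ℕ,
      ((∀ t ∈ Finset.Icc 1 T, ∀ ht : 1 ≤ t, 0 < Q t →
        h t =ᵐ[P] condTiltMean P X Y (fun s => -μ * Q s) h t ht) ↔
      ∀ t ∈ Finset.Icc 1 T, 0 < Q t → h t =ᵐ[P] Ztilde P X Y ε (fun s => -μ * Q s) h t) := by
    intro hG h hh T
    refine forall₂_congr fun t htT => ?_
    have ht := (Finset.mem_Icc.1 htT).1
    exact ⟨fun H hQt => (H ht hQt).trans (hZ hG h hh t ht).symm,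
      fun H _ hQt => (H hQt).trans (hZ hG h hh t ht)⟩
  refine ⟨fun hyp => ?_, fun hyp h hh T => ?_⟩
  · have hG : IsCondGaussian P X Y :=
      hyp.elim (fun hJ => (hJ.isCondGaussian P hX hY).1) id
    have ho := isAdapted_optFilter P X Y (fun s => -μ * Q s)
    refine ⟨⟨_, ho, fun t ht => ?_⟩, fun h hh T => ?_⟩
    · rw [optFilter_eq P X Y _ t ht]
      exact (hZ hG _ ho t ht).symm
    · rw [isRSSolution_iff P hX hY hQ hμ hG hh T, hiff hG h hh T]
  · obtain ⟨hG, hC⟩ := hyp.elim (fun hJ => hJ.isCondGaussian P hX hY) id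
    rw [isLEGSolution_iff P hX hY hQ hμ hG hC hh T, hiff hG h hh T]
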